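/- **Setting.** A *world* $\mathbf U=(U,\partial_U)$ is a non-empty finite cardinal $U$ of clock names with a time assignment $\partial_U:U\to\mathbb N$. A morphism $f:\mathbf V\to\mathbf U$ is a function $f^*:U\to V$ with $\partial_V(f^*\kappa)\le\partial_U(\kappa)$ for all $\kappa\in U$. Let $\mathcal S$ be the topos of presheaves of sets on the category of worlds, and $\mathrm{Clk}\in\mathcal S$ the presheaf $\mathbf U\mapsto U$. Everything below is defined, and read, in the internal (Kripke–Joyal) logic of $\mathcal S$; "true" means forced at every world. For $\kappa:\mathrm{Clk}$ the modality $\triangleright_\kappa$ on truth values is: $\mathbf U\Vdash\triangleright_\kappa\varphi$ always holds if $\partial_U(\kappa)=0$, and means $\mathbf U[\kappa\mapsto m]\Vdash\varphi$ (with $\varphi$ restricted along the evident map $\mathbf U[\kappa\mapsto m]\to\mathbf U$) if $\partial_U(\kappa)=m+1$. **Programs.** $\mathrm{Tm}_n$ (programs with $n$ free variables) is the inductive family in $\mathcal S$ generated by: variables; $\lambda x.M$; $M(N)$; $\lambda F$ for $F\in\mathrm{Tm}_n^{\mathrm{Clk}}$; $M(\kappa)$ for $\kappa:\mathrm{Clk}$;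 $\mathsf{fix}\,x.M$; $\langle M,N\rangle$; $M.1$; $M.2$; $\star$; $\mathsf{tt}$; $\mathsf{ff}$; $\mathsf{if}(M;N;O)$; $\mathsf{ze}$; $\mathsf{su}(M)$; $\mathsf{ifze}(M;N;x.O)$; $\mathsf{sup}(M;x.N)$; $\mathsf{wrec}(M;xyz.O)$; $\Pi x{:}A.B$; $\Sigma x{:}A.B$; $\mathsf Wx{:}A.B$; $\mathsf{Eq}_A(M,N)$; $\triangleright_\kappa A$ for $\kappa:\mathrm{Clk}$; the clock intersection $\bigcap F$ and the clock product $\prod F$ for $F\in\mathrm{Tm}_n^{\mathrm{Clk}}$; $\mathsf{void}$, $\mathsf{unit}$, $\mathsf{bool}$, $\mathsf{nat}$; and $\mathsf U_i$ for $i\in\mathbb N$. Write $\mathrm{Tm}=\mathrm{Tm}_0$. *Values* are the closed programs of the introduction forms ($\lambda x.M$, $\lambda F$, $\langle M,N\rangle$, $\star$, $\mathsf{tt}$, $\mathsf{ff}$, $\mathsf{ze}$, $\mathsf{su}(M)$, $\mathsf{sup}(M;x.N)$) and of all type forms. The transition relation $\mapsto$ on $\mathrm{Tm}$ is generated by evaluation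 of the principal argument of $M(N)$, $M(\kappa)$, $M.1$, $M.2$, $\mathsf{if}$, $\mathsf{ifze}$, $\mathsf{wrec}$, together with $(\lambda x.M)(N)\mapsto M[N/x]$, $(\lambda F)(\kappa)\mapsto F(\kappa)$, $\langle M,N\rangle.1\mapsto M$, $\langle M,N\rangle.2\mapsto N$, $\mathsf{if}(\mathsf{tt};N;O)\mapsto N$, $\mathsf{if}(\mathsf{ff};N;O)\mapsto O$, $\mathsf{ifze}(\mathsf{ze};N;x.O)\mapsto N$, $\mathsf{ifze}(\mathsf{su}(M);N;x.O)\mapsto O[M/x]$, $\mathsf{wrec}(\mathsf{sup}(M;u.N);xyz.O)\mapsto O[M/x,\ \lambda u.N/y,\ \lambda u.\mathsf{wrec}(N;xyz.O)/z]$, $\mathsf{fix}\,x.M\mapsto M[\mathsf{fix}\,x.M/x]$. Write $M\Downarrow v$ if $M\mapsto^* v$ and $v$ is a value, and $M\preceq M'$ if $M\Downarrow v$ implies $M'\Downarrow v$ for all $v$. **Type systems.** Let $\mathrm{Rel}=\mathcal P(\mathrm{Tm}\times\mathrm{Tm})$. A *candidate type system* is an element $\tau$ of $\mathrm{PTS}=\mathcal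 P(\mathrm{Tm}\times\mathrm{Rel})$. A relation $\mathcal R:\mathrm{Rel}$ is a *computational PER* if it is symmetric and transitive, and $(M,N)\in\mathcal R$, $M\preceq M'$ imply $(M',N)\in\mathcal R$. The candidate $\tau$ is a *type system* if it is (1) *extensional*: $(A,\mathcal A),(A,\mathcal A')\in\tau$ imply $\mathcal A=\mathcal A'$, i.e. $\tau$ is the graph of a partial function; (2) *computational-PER-valued*: $(A,\mathcal A)\in\tau$ implies that $\mathcal A$ is a computational PER; (3) *type-computational*: $(A,\mathcal A)\in\tau$ and $A\preceq A'$ imply $(A',\mathcal A)\in\tau$. **Closure.** Put $\mathcal A^\Downarrow=\{(M,N)\mid\exists v,w.\ M\Downarrow v,\ N\Downarrow w,\ (v,w)\in\mathcal A\}$ and $\tau^\Downarrow=\{(A,\mathcal A)\mid\exists v.\ A\Downarrow v,\ (v,\mathcal A)\in\tau\}$. Let $\mathrm{Conn}(\tau)$ be the set of the following pairs, where in the clauses for $\Sigma,\Pi,\mathsf W$ there are $\mathcal A:\mathrm{Rel}$ and $\mathcal B:\mathrm{Rel}^{\mathrm{Tm}}$ with $(A,\mathcal A)\in\tau$ and $(B[M_i/x],\mathcal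 B(M_j))\in\tau$ for all $(M_0,M_1)\in\mathcal A$ and $i,j\in\{0,1\}$: - $(\mathsf{void},\varnothing)$, $(\mathsf{unit},\{(\star,\star)\}^\Downarrow)$, $(\mathsf{bool},\{(\mathsf{tt},\mathsf{tt}),(\mathsf{ff},\mathsf{ff})\}^\Downarrow)$; - $(\mathsf{nat},\mathcal X^\Downarrow)$, $\mathcal X$ the least $\mathcal Y$ with $\mathcal Y=\{(\mathsf{ze},\mathsf{ze})\}\cup\{(\mathsf{su}(M_0),\mathsf{su}(M_1))\mid(M_0,M_1)\in\mathcal Y^\Downarrow\}$; - $(\Sigma x{:}A.B,\ \{(M_0,M_1)\mid(M_0.1,M_1.1)\in\mathcal A\wedge(M_0.2,M_1.2)\in\mathcal B(M_0.1)\})$; - $(\Pi x{:}A.B,\ \{(M_0,M_1)\mid\forall(N_0,N_1)\in\mathcal A.\ (M_0(N_0),M_1(N_1))\in\mathcal B(N_0)\})$; - $(\mathsf Wx{:}A.B,\ \mathcal X^\Downarrow)$, $\mathcal X$ the least $\mathcal Y$ with $\mathcal Y=\{(\mathsf{sup}(M_0;u.N_0),\mathsf{sup}(M_1;u.N_1))\mid(M_0,M_1)\in\mathcal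 A\wedge\forall(O_0,O_1)\in\mathcal B(M_0).\ (N_0[O_0/u],N_1[O_1/u])\in\mathcal Y^\Downarrow\}$; - $(\mathsf{Eq}_A(M_0,M_1),\ \{(\star,\star)\mid(M_0,M_1)\in\mathcal A\}^\Downarrow)$ where $(A,\mathcal A)\in\tau$ and $(M_0,M_0),(M_1,M_1)\in\mathcal A$; - $(\triangleright_\kappa A,\ \{(M_0,M_1)\mid\triangleright_\kappa((M_0,M_1)\in\mathcal A)\})$ where $\mathcal A:\mathrm{Rel}$ and $\triangleright_\kappa((A,\mathcal A)\in\tau)$; - $(\bigcap F,\ \{(M_0,M_1)\mid\forall\kappa.\ (M_0,M_1)\in\mathcal A(\kappa)\})$ and $(\prod F,\ \{(M_0,M_1)\mid\forall\kappa.\ (M_0(\kappa),M_1(\kappa))\in\mathcal A(\kappa)\})$ where $\mathcal A:\mathrm{Rel}^{\mathrm{Clk}}$ and $(F(\kappa),\mathcal A(\kappa))\in\tau$ for all $\kappa$. For $\sigma:\mathrm{PTS}$ the operator $\Phi_\sigma(\tau)=\sigma\cup\mathrm{Conn}(\tau)^\Downarrow$ on $\mathrm{PTS}$ is monotone; let $\mathrm{Cl}(\sigma)$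 be its (Knaster–Tarski) least fixed point. **Hierarchy.** Define by complete induction $\nu_0=\varnothing$ and $$\nu_{n+1}=\bigl\{(\mathsf U_i,\mathcal U_i)\bigm| i\le n\bigr\}^\Downarrow,\qquad \mathcal U_i=\{(A_0,A_1)\mid\exists\mathcal A:\mathrm{Rel}.\ (A_0,\mathcal A),(A_1,\mathcal A)\in\mathrm{Cl}(\nu_i)\},$$ and put $\tau_n=\mathrm{Cl}(\nu_n)$ and $\tau_\omega=\bigvee_{n\in\mathbb N}\tau_n$. **Theorem.** $\tau_\omega$ is a type system, i.e. it is true in $\mathcal S$ that $\tau_\omega$ is extensional, computational-PER-valued and type-computational. -/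

import Mathlib

open CategoryTheory Opposite

namespace GCTT

/-! ## The base category of clock worlds and its presheaf topos -/

/-- A world: a non-empty finite cardinal of clock names, with the time left on each clock. -/
structure World where
  card : ℕ
  card_pos : 0 < card
  time : Fin card → ℕ

/-- A morphism `V ⟶ U` is a vector of projections, i.e. a function from the clock names of `U`
to those of `V`, along which the time assignment of `V` is bounded by that of `U`. -/
@[ext]
structure World.Hom (V U : World) where
  toFun : Fin U.card → Fin V.card
  time_le : ∀ κ, V.time (toFun κ) ≤ U.time κ

instance : SmallCategory World where
  Hom := World.Hom
  id U := ⟨fun κ => κ, fun _ => le_rfl⟩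
  comp f g := ⟨fun κ => f.toFun (g.toFun κ), fun κ => (f.time_le _).trans (g.time_le κ)⟩

theorem World.hom_ext {V U : World} {f g : V ⟶ U} (h : f.toFun = g.toFun) : f = g :=
  World.Hom.ext h

theorem World.comp_toFun {W V U : World} (g : W ⟶ V) (f : V ⟶ U) (κ : Fin U.card) :
    (g ≫ f).toFun κ = g.toFun (f.toFun κ) := rfl

theorem World.id_toFun {U : World} (κ : Fin U.card) : (𝟙 U : U ⟶ U).toFun κ = κ := rfl

/-- `U[κ ↦ m]`. -/
def World.set (U : World) (κ : Fin U.card) (m : ℕ) : World :=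
  ⟨U.card, U.card_pos, Function.update U.time κ m⟩

/-- If the clock `κ` has time `m + 1` in `U`, then incrementing `κ` is a map `U[κ ↦ m] ⟶ U`. -/
def World.tick (U : World) (κ : Fin U.card) (m : ℕ) (h : U.time κ = m + 1) : U.set κ m ⟶ U where
  toFun := fun κ' => κ'
  time_le := by
    intro κ'
    by_cases hk : κ' = κ
    · subst hk
      simp [World.set, h]
    · simp [World.set, Function.update_of_ne hk]

/-- A morphism `g : V ⟶ U` induces `V[g κ ↦ n] ⟶ U[κ ↦ m]` when both clocks tick. -/
def World.setMap {V U : World} (g : V ⟶ U) (κ : Fin U.card) (m n : ℕ)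
    (hU : U.time κ = m + 1) (hV : V.time (g.toFun κ) = n + 1) :
    V.set (g.toFun κ) n ⟶ U.set κ m where
  toFun := g.toFun
  time_le := by
    intro (κ' : Fin U.card)
    have h1 := g.time_le κ
    have h2 := g.time_le κ'
    change Function.update V.time (g.toFun κ) n (g.toFun κ') ≤ Function.update U.time κ m κ'
    by_cases hk : κ' = κ
    · rw [hk, Function.update_self, Function.update_self]
      omega
    · rw [Function.update_of_ne hk]
      by_cases hg : g.toFun κ' = g.toFun κ
      · rw [hg] at h2 ⊢
        rw [Function.update_self]
        omega
      · rwa [Function.update_of_ne hg]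

theorem World.setMap_tick {V U : World} (g : V ⟶ U) (κ : Fin U.card) (m n : ℕ)
    (hU : U.time κ = m + 1) (hV : V.time (g.toFun κ) = n + 1) :
    World.setMap g κ m n hU hV ≫ U.tick κ m hU = V.tick (g.toFun κ) n hV ≫ g := rfl

/-- The topos of clocks: presheaves on worlds. -/
abbrev ClkTopos := Worldᵒᵖ ⥤ Type

/-- Elements of a presheaf at a world. -/
abbrev El (X : ClkTopos) (U : World) : Type := X.obj (op U)

/-- Restriction of an element along a map of worlds. -/
abbrev res {X : ClkTopos} {U V : World} (x : El X U) (f : V ⟶ U) : El X V := X.map f.op x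

theorem res_id {X : ClkTopos} {U : World} (x : El X U) : res x (𝟙 U) = x := by
  simp [res]

theorem res_res {X : ClkTopos} {U V W : World} (x : El X U) (f : V ⟶ U) (g : W ⟶ V) :
    res (res x f) g = res x (g ≫ f) := by
  simp [res]

/-- The object of clock names. -/
abbrev Clk : ClkTopos where
  obj U := Fin U.unop.card
  map f := ↾f.unop.toFun

/-! ### Exponentials and power objects -/

/-- Elements at `U` of the exponential `Y ^ X`. -/
@[ext]
structure ExpAt (X Y : ClkTopos) (U : World) where
  app : ∀ ⦃V : World⦄, (V ⟶ U) → El X V → El Y V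
  natural : ∀ ⦃V W : World⦄ (f : V ⟶ U) (g : W ⟶ V) (x : El X V),
    res (app f x) g = app (g ≫ f) (res x g)

/-- The exponential `Y ^ X` in the topos. -/
abbrev Exp (X Y : ClkTopos) : ClkTopos where
  obj U := ExpAt X Y U.unop
  map f := ↾fun h => ⟨fun _ g x => h.app (g ≫ f.unop) x, fun _ _ g k x => by
    rw [h.natural, Category.assoc]⟩

/-- Elements at `U` of the power object of `X`: the predicates on `X` over `U`, i.e. the
subpresheaves of `よ U × X`; `mem f x` says that `x` belongs to the restriction along `f`. -/
@[ext]
structure PowAt (X : ClkTopos) (U : World) where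
  mem : ∀ ⦃V : World⦄, (V ⟶ U) → El X V → Prop
  mono : ∀ ⦃V W : World⦄ (f : V ⟶ U) (g : W ⟶ V) (x : El X V),
    mem f x → mem (g ≫ f) (res x g)

/-- The power object of `X`. -/
abbrev Pow (X : ClkTopos) : ClkTopos where
  obj U := PowAt X U.unop
  map f := ↾fun R => ⟨fun _ g x => R.mem (g ≫ f.unop) x, fun _ _ g k x h => by
    simpa only [Category.assoc] using R.mono (g ≫ f.unop) k x h⟩

namespace PowAt

variable {X : ClkTopos} {U : World}

instance : PartialOrder (PowAt X U) where
  le R S := ∀ ⦃V : World⦄ (f : V ⟶ U) (x : El X V), R.mem f x → S.mem f x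
  le_refl _ _ _ _ h := h
  le_trans _ _ _ h₁ h₂ _ f x h := h₂ f x (h₁ f x h)
  le_antisymm R S h₁ h₂ := by
    ext V f x
    exact ⟨h₁ f x, h₂ f x⟩

instance : CompleteLattice (PowAt X U) where
  sup R S := ⟨fun _ f x => R.mem f x ∨ S.mem f x, fun _ _ f g x h =>
    h.imp (R.mono f g x) (S.mono f g x)⟩
  le_sup_left _ _ _ _ _ h := Or.inl h
  le_sup_right _ _ _ _ _ h := Or.inr h
  sup_le _ _ _ h₁ h₂ _ f x h := h.elim (h₁ f x) (h₂ f x)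
  inf R S := ⟨fun _ f x => R.mem f x ∧ S.mem f x, fun _ _ f g x h =>
    ⟨R.mono f g x h.1, S.mono f g x h.2⟩⟩
  inf_le_left _ _ _ _ _ h := h.1
  inf_le_right _ _ _ _ _ h := h.2
  le_inf _ _ _ h₁ h₂ _ f x h := ⟨h₁ f x h, h₂ f x h⟩
  sSup 𝒮 := ⟨fun _ f x => ∃ R ∈ 𝒮, R.mem f x, fun _ _ f g x ⟨R, hR, h⟩ =>
    ⟨R, hR, R.mono f g x h⟩⟩
  isLUB_sSup _ := ⟨fun R hR _ _ _ h => ⟨R, hR, h⟩, fun _ hS _ f x ⟨_, hR, h⟩ => hS hR f x h⟩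
  sInf 𝒮 := ⟨fun _ f x => ∀ R ∈ 𝒮, R.mem f x, fun _ _ f g x h R hR =>
    R.mono f g x (h R hR)⟩
  isGLB_sInf _ := ⟨fun R hR _ _ _ h => h R hR, fun _ hS _ f x h _ hR => hS hR f x h⟩
  top := ⟨fun _ _ _ => True, fun _ _ _ _ _ _ => trivial⟩
  le_top _ _ _ _ _ := trivial
  bot := ⟨fun _ _ _ => False, fun _ _ _ _ _ h => h⟩
  bot_le _ _ _ _ h := h.elim

/-- Reindexing of predicates along a map of worlds. -/
def restrict {V : World} (R : PowAt X U) (f : V ⟶ U) : PowAt X V := res (X := Pow X) R f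

theorem mem_restrict {V W : World} (R : PowAt X U) (f : V ⟶ U) (g : W ⟶ V) (x : El X W) :
    (R.restrict f).mem g x ↔ R.mem (g ≫ f) x := Iff.rfl

theorem restrict_mono {V : World} {R S : PowAt X U} (h : R ≤ S) (f : V ⟶ U) :
    R.restrict f ≤ S.restrict f := fun _ g x => h (g ≫ f) x

/-- Right adjoint to reindexing of predicates. -/
def all {V : World} (f : V ⟶ U) (S : PowAt X V) : PowAt X U where
  mem _ g x := ∀ ⦃W' : World⦄ (h : W' ⟶ _) (k : W' ⟶ V), h ≫ g = k ≫ f → S.mem k (res x h)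
  mono V W g l x H W' h k e := by
    have := H (h ≫ l) k (by rw [Category.assoc, e])
    rwa [← res_res] at this

theorem restrict_le_iff {V : World} (f : V ⟶ U) (R : PowAt X U) (S : PowAt X V) :
    R.restrict f ≤ S ↔ R ≤ all f S := by
  constructor
  · intro H W g x hx W' h k e
    apply H
    rw [mem_restrict, ← e]
    exact R.mono g h x hx
  · intro H W g x hx
    have := H (g ≫ f) x hx (𝟙 W) g (by simp)
    rwa [res_id] at this

/-- Least fixed points of monotone operators on predicates commute with reindexing, as soon as
the operator does. -/
theorem restrict_lfp {V : World} (f : V ⟶ U) (Φ : PowAt X U →o PowAt X U)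
    (Ψ : PowAt X V →o PowAt X V) (h : ∀ R, (Φ R).restrict f = Ψ (R.restrict f)) :
    Φ.lfp.restrict f = Ψ.lfp := by
  apply le_antisymm
  · rw [restrict_le_iff]
    apply OrderHom.lfp_le
    rw [← restrict_le_iff, h]
    calc Ψ ((all f Ψ.lfp).restrict f) ≤ Ψ Ψ.lfp :=
          Ψ.mono ((restrict_le_iff f _ _).2 le_rfl)
      _ = Ψ.lfp := Ψ.map_lfp
  · apply OrderHom.lfp_le
    rw [← h, Φ.map_lfp]

end PowAt

/-- The truth value `▷κ φ` at `U`, for `κ` a clock at `U` and `φ` a truth value over `U`: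
it is `⊤` if the time left on `κ` is `0`, and it is `φ` at `U[κ ↦ m]` if that time is `m + 1`. -/
def Later {U : World} (κ : Fin U.card) (φ : ∀ ⦃V : World⦄, (V ⟶ U) → Prop) : Prop :=
  ∀ (m : ℕ) (h : U.time κ = m + 1), φ (U.tick κ m h)

theorem Later.imp {U : World} {κ : Fin U.card} {φ ψ : ∀ ⦃V : World⦄, (V ⟶ U) → Prop}
    (H : ∀ ⦃V : World⦄ (f : V ⟶ U), φ f → ψ f) (h : Later κ φ) : Later κ ψ :=
  fun m e => H _ (h m e)

theorem Later.mono {U V : World} {κ : Fin U.card} {φ : ∀ ⦃V : World⦄, (V ⟶ U) → Prop}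
    (hφ : ∀ ⦃V W : World⦄ (f : V ⟶ U) (g : W ⟶ V), φ f → φ (g ≫ f)) (g : V ⟶ U)
    (h : Later κ φ) : Later (g.toFun κ) (fun _ k => φ (k ≫ g)) := by
  intro n hn
  have hle := g.time_le κ
  obtain ⟨m, hm⟩ : ∃ m, U.time κ = m + 1 := ⟨U.time κ - 1, by omega⟩
  rw [← World.setMap_tick g κ m n hm hn]
  exact hφ _ _ (h m hm)

/-! ## Programs -/

/-- Raw programs with `n` free variables at a world. Binders of clocks carry families of programs
indexed by the clocks of all later worlds. -/
inductive PreTm : World → ℕ → Type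
  | var {U : World} {n : ℕ} (i : Fin n) : PreTm U n
  | lam {U : World} {n : ℕ} (M : PreTm U (n + 1)) : PreTm U n
  | app {U : World} {n : ℕ} (M N : PreTm U n) : PreTm U n
  | klam {U : World} {n : ℕ} (M : ∀ V : World, (V ⟶ U) → Fin V.card → PreTm V n) : PreTm U n
  | kapp {U : World} {n : ℕ} (M : PreTm U n) (κ : Fin U.card) : PreTm U n
  | fix {U : World} {n : ℕ} (M : PreTm U (n + 1)) : PreTm U n
  | pair {U : World} {n : ℕ} (M N : PreTm U n) : PreTm U n
  | fst {U : World} {n : ℕ} (M : PreTm U n) : PreTm U n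
  | snd {U : World} {n : ℕ} (M : PreTm U n) : PreTm U n
  | star {U : World} {n : ℕ} : PreTm U n
  | tt {U : World} {n : ℕ} : PreTm U n
  | ff {U : World} {n : ℕ} : PreTm U n
  | ite {U : World} {n : ℕ} (Mb Mt Mf : PreTm U n) : PreTm U n
  | ze {U : World} {n : ℕ} : PreTm U n
  | su {U : World} {n : ℕ} (M : PreTm U n) : PreTm U n
  | ifze {U : World} {n : ℕ} (Mn Mz : PreTm U n) (Ms : PreTm U (n + 1)) : PreTm U n
  | sup {U : World} {n : ℕ} (M : PreTm U n) (N : PreTm U (n + 1)) : PreTm U n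
  | wrec {U : World} {n : ℕ} (M : PreTm U n) (N : PreTm U (n + 3)) : PreTm U n
  | pi {U : World} {n : ℕ} (A : PreTm U n) (B : PreTm U (n + 1)) : PreTm U n
  | sg {U : World} {n : ℕ} (A : PreTm U n) (B : PreTm U (n + 1)) : PreTm U n
  | wty {U : World} {n : ℕ} (A : PreTm U n) (B : PreTm U (n + 1)) : PreTm U n
  | eq {U : World} {n : ℕ} (A M N : PreTm U n) : PreTm U n
  | ltr {U : World} {n : ℕ} (κ : Fin U.card) (A : PreTm U n) : PreTm U n
  | isect {U : World} {n : ℕ} (A : ∀ V : World, (V ⟶ U) → Fin V.card → PreTm V n) : PreTm U n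
  | kprod {U : World} {n : ℕ} (A : ∀ V : World, (V ⟶ U) → Fin V.card → PreTm V n) : PreTm U n
  | void {U : World} {n : ℕ} : PreTm U n
  | unit {U : World} {n : ℕ} : PreTm U n
  | bool {U : World} {n : ℕ} : PreTm U n
  | nat {U : World} {n : ℕ} : PreTm U n
  | univ {U : World} {n : ℕ} (i : ℕ) : PreTm U n

namespace PreTm

/-- Restriction along a map of worlds. -/
def res {U V : World} {n : ℕ} (f : V ⟶ U) : PreTm U n → PreTm V n
  | var i => var i
  | lam M => lam (M.res f)
  | app M N => app (M.res f) (N.res f)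
  | klam M => klam fun W g κ => M W (g ≫ f) κ
  | kapp M κ => kapp (M.res f) (f.toFun κ)
  | fix M => fix (M.res f)
  | pair M N => pair (M.res f) (N.res f)
  | fst M => fst (M.res f)
  | snd M => snd (M.res f)
  | star => star
  | tt => tt
  | ff => ff
  | ite Mb Mt Mf => ite (Mb.res f) (Mt.res f) (Mf.res f)
  | ze => ze
  | su M => su (M.res f)
  | ifze Mn Mz Ms => ifze (Mn.res f) (Mz.res f) (Ms.res f)
  | sup M N => sup (M.res f) (N.res f)
  | wrec M N => wrec (M.res f) (N.res f)
  | pi A B => pi (A.res f) (B.res f)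
  | sg A B => sg (A.res f) (B.res f)
  | wty A B => wty (A.res f) (B.res f)
  | eq A M N => eq (A.res f) (M.res f) (N.res f)
  | ltr κ A => ltr (f.toFun κ) (A.res f)
  | isect A => isect fun W g κ => A W (g ≫ f) κ
  | kprod A => kprod fun W g κ => A W (g ≫ f) κ
  | void => void
  | unit => unit
  | bool => bool
  | nat => nat
  | univ i => univ i

/-- Every clock-indexed family occurring in the program is, hereditarily, an element of the
exponential by the object of clocks. -/
def Natural {U : World} {n : ℕ} : PreTm U n → Prop
  | var _ => True
  | lam M => M.Natural
  | app M N => M.Natural ∧ N.Natural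
  | @klam U n M => (∀ V f κ, (M V f κ).Natural) ∧
      ∀ (V W : World) (f : V ⟶ U) (g : W ⟶ V) κ, (M V f κ).res g = M W (g ≫ f) (g.toFun κ)
  | kapp M _ => M.Natural
  | fix M => M.Natural
  | pair M N => M.Natural ∧ N.Natural
  | fst M => M.Natural
  | snd M => M.Natural
  | star => True
  | tt => True
  | ff => True
  | ite Mb Mt Mf => Mb.Natural ∧ Mt.Natural ∧ Mf.Natural
  | ze => True
  | su M => M.Natural
  | ifze Mn Mz Ms => Mn.Natural ∧ Mz.Natural ∧ Ms.Natural
  | sup M N => M.Natural ∧ N.Natural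
  | wrec M N => M.Natural ∧ N.Natural
  | pi A B => A.Natural ∧ B.Natural
  | sg A B => A.Natural ∧ B.Natural
  | wty A B => A.Natural ∧ B.Natural
  | eq A M N => A.Natural ∧ M.Natural ∧ N.Natural
  | ltr _ A => A.Natural
  | @isect U n A => (∀ V f κ, (A V f κ).Natural) ∧
      ∀ (V W : World) (f : V ⟶ U) (g : W ⟶ V) κ, (A V f κ).res g = A W (g ≫ f) (g.toFun κ)
  | @kprod U n A => (∀ V f κ, (A V f κ).Natural) ∧
      ∀ (V W : World) (f : V ⟶ U) (g : W ⟶ V) κ, (A V f κ).res g = A W (g ≫ f) (g.toFun κ)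
  | void => True
  | unit => True
  | bool => True
  | nat => True
  | univ _ => True

/-- Extension of a renaming under a binder. -/
def upRen {n m : ℕ} (ρ : Fin n → Fin m) : Fin (n + 1) → Fin (m + 1) :=
  Fin.cases 0 fun i => (ρ i).succ

/-- Renaming of variables. -/
def rename {U : World} {n m : ℕ} (ρ : Fin n → Fin m) : PreTm U n → PreTm U m
  | var i => var (ρ i)
  | lam M => lam (M.rename (upRen ρ))
  | app M N => app (M.rename ρ) (N.rename ρ)
  | klam M => klam fun V f κ => (M V f κ).rename ρ
  | kapp M κ => kapp (M.rename ρ) κ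
  | fix M => fix (M.rename (upRen ρ))
  | pair M N => pair (M.rename ρ) (N.rename ρ)
  | fst M => fst (M.rename ρ)
  | snd M => snd (M.rename ρ)
  | star => star
  | tt => tt
  | ff => ff
  | ite Mb Mt Mf => ite (Mb.rename ρ) (Mt.rename ρ) (Mf.rename ρ)
  | ze => ze
  | su M => su (M.rename ρ)
  | ifze Mn Mz Ms => ifze (Mn.rename ρ) (Mz.rename ρ) (Ms.rename (upRen ρ))
  | sup M N => sup (M.rename ρ) (N.rename (upRen ρ))
  | wrec M N => wrec (M.rename ρ) (N.rename (upRen (upRen (upRen ρ))))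
  | pi A B => pi (A.rename ρ) (B.rename (upRen ρ))
  | sg A B => sg (A.rename ρ) (B.rename (upRen ρ))
  | wty A B => wty (A.rename ρ) (B.rename (upRen ρ))
  | eq A M N => eq (A.rename ρ) (M.rename ρ) (N.rename ρ)
  | ltr κ A => ltr κ (A.rename ρ)
  | isect A => isect fun V f κ => (A V f κ).rename ρ
  | kprod A => kprod fun V f κ => (A V f κ).rename ρ
  | void => void
  | unit => unit
  | bool => bool
  | nat => nat
  | univ i => univ i

/-- Extension of a substitution under a binder. -/
def up {U : World} {n m : ℕ} (γ : Fin n → PreTm U m) : Fin (n + 1) → PreTm U (m + 1) :=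
  Fin.cases (var 0) fun i => (γ i).rename Fin.succ

/-- Simultaneous substitution. -/
def subst {U : World} {n m : ℕ} (γ : Fin n → PreTm U m) : PreTm U n → PreTm U m
  | var i => γ i
  | lam M => lam (M.subst (up γ))
  | app M N => app (M.subst γ) (N.subst γ)
  | klam M => klam fun V f κ => (M V f κ).subst fun i => (γ i).res f
  | kapp M κ => kapp (M.subst γ) κ
  | fix M => fix (M.subst (up γ))
  | pair M N => pair (M.subst γ) (N.subst γ)
  | fst M => fst (M.subst γ)
  | snd M => snd (M.subst γ)
  | star => star
  | tt => tt
  | ff => ff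
  | ite Mb Mt Mf => ite (Mb.subst γ) (Mt.subst γ) (Mf.subst γ)
  | ze => ze
  | su M => su (M.subst γ)
  | ifze Mn Mz Ms => ifze (Mn.subst γ) (Mz.subst γ) (Ms.subst (up γ))
  | sup M N => sup (M.subst γ) (N.subst (up γ))
  | wrec M N => wrec (M.subst γ) (N.subst (up (up (up γ))))
  | pi A B => pi (A.subst γ) (B.subst (up γ))
  | sg A B => sg (A.subst γ) (B.subst (up γ))
  | wty A B => wty (A.subst γ) (B.subst (up γ))
  | eq A M N => eq (A.subst γ) (M.subst γ) (N.subst γ)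
  | ltr κ A => ltr κ (A.subst γ)
  | isect A => isect fun V f κ => (A V f κ).subst fun i => (γ i).res f
  | kprod A => kprod fun V f κ => (A V f κ).subst fun i => (γ i).res f
  | void => void
  | unit => unit
  | bool => bool
  | nat => nat
  | univ i => univ i

/-- Substitution of a closed program for the only variable. -/
def inst {U : World} (B : PreTm U 1) (M : PreTm U 0) : PreTm U 0 := B.subst fun _ => M

/-- Substitution of three closed programs; `P` replaces the innermost variable. -/
def inst₃ {U : World} (O : PreTm U 3) (M N P : PreTm U 0) : PreTm U 0 := O.subst ![P, N, M]

theorem res_id {U : World} {n : ℕ} (t : PreTm U n) : t.res (𝟙 U) = t := by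
  induction t <;> simp_all [res, World.id_toFun]

theorem res_res {U V W : World} {n : ℕ} (f : V ⟶ U) (g : W ⟶ V) (t : PreTm U n) :
    (t.res f).res g = t.res (g ≫ f) := by
  induction t generalizing V W <;> simp_all [res, World.comp_toFun]

theorem Natural.res {U V : World} {n : ℕ} (f : V ⟶ U) {t : PreTm U n} (h : t.Natural) :
    (t.res f).Natural := by
  induction t generalizing V <;> simp_all [PreTm.res, Natural]

theorem res_rename {U V : World} {n m : ℕ} (ρ : Fin n → Fin m) (f : V ⟶ U) (t : PreTm U n) :
    (t.rename ρ).res f = (t.res f).rename ρ := by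
  induction t generalizing V m <;> simp_all [PreTm.res, rename]

theorem Natural.rename {U : World} {n m : ℕ} (ρ : Fin n → Fin m) {t : PreTm U n}
    (h : t.Natural) : (t.rename ρ).Natural := by
  induction t generalizing m <;> simp_all [PreTm.rename, Natural, res_rename]

theorem up_res {U V : World} {n m : ℕ} (γ : Fin n → PreTm U m) (f : V ⟶ U) :
    (fun i => (up γ i).res f) = up fun i => (γ i).res f := by
  funext i
  refine Fin.cases ?_ (fun i => ?_) i
  · rfl
  · simp [up, res_rename]

theorem res_subst {U V : World} {n m : ℕ} (γ : Fin n → PreTm U m) (f : V ⟶ U) (t : PreTm U n) :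
    (t.subst γ).res f = (t.res f).subst fun i => (γ i).res f := by
  induction t generalizing V m <;> simp_all [PreTm.res, subst, up_res, res_res]

theorem Natural.up {U : World} {n m : ℕ} {γ : Fin n → PreTm U m} (h : ∀ i, (γ i).Natural) :
    ∀ i, (PreTm.up γ i).Natural := by
  intro i
  refine Fin.cases ?_ (fun i => ?_) i
  · trivial
  · exact (h i).rename _

theorem Natural.subst {U : World} {n m : ℕ} {γ : Fin n → PreTm U m} (hγ : ∀ i, (γ i).Natural)
    {t : PreTm U n} (h : t.Natural) : (t.subst γ).Natural := by
  induction t generalizing m with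
  | wrec M N ihM ihN =>
    exact ⟨ihM hγ h.1, ihN (Natural.up (Natural.up (Natural.up hγ))) h.2⟩
  | _ => simp_all [PreTm.subst, Natural, res_subst, res_res, Natural.up, Natural.res]

theorem res_inst {U V : World} (f : V ⟶ U) (B : PreTm U 1) (M : PreTm U 0) :
    (B.inst M).res f = (B.res f).inst (M.res f) := res_subst _ _ _

theorem res_inst₃ {U V : World} (f : V ⟶ U) (O : PreTm U 3) (M N P : PreTm U 0) :
    (O.inst₃ M N P).res f = (O.res f).inst₃ (M.res f) (N.res f) (P.res f) := by
  rw [inst₃, res_subst, inst₃]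
  congr 1
  funext i
  fin_cases i <;> rfl

/-! ### Operational semantics -/

/-- Canonical forms. -/
inductive Val {U : World} : PreTm U 0 → Prop
  | lam (M) : Val (lam M)
  | klam (M) : Val (klam M)
  | pair (M N) : Val (pair M N)
  | star : Val star
  | tt : Val tt
  | ff : Val ff
  | ze : Val ze
  | su (M) : Val (su M)
  | sup (M N) : Val (sup M N)
  | pi (A B) : Val (pi A B)
  | sg (A B) : Val (sg A B)
  | wty (A B) : Val (wty A B)
  | eq (A M N) : Val (eq A M N)
  | ltr (κ A) : Val (ltr κ A)
  | isect (A) : Val (isect A)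
  | kprod (A) : Val (kprod A)
  | void : Val void
  | unit : Val unit
  | bool : Val bool
  | nat : Val nat
  | univ (i) : Val (univ i)

/-- Small-step transitions of closed programs. -/
inductive Step {U : World} : PreTm U 0 → PreTm U 0 → Prop
  | app {M M' N} : Step M M' → Step (app M N) (app M' N)
  | kapp {M M' κ} : Step M M' → Step (kapp M κ) (kapp M' κ)
  | fst {M M'} : Step M M' → Step (fst M) (fst M')
  | snd {M M'} : Step M M' → Step (snd M) (snd M')
  | ite {M M' Mt Mf} : Step M M' → Step (ite M Mt Mf) (ite M' Mt Mf)
  | ifze {M M' Mz Ms} : Step M M' → Step (ifze M Mz Ms) (ifze M' Mz Ms)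
  | wrec {M M' N} : Step M M' → Step (wrec M N) (wrec M' N)
  | app_lam {M N} : Step (app (lam M) N) (M.inst N)
  | kapp_klam {M κ} : Step (kapp (klam M) κ) (M U (𝟙 U) κ)
  | fst_pair {M N} : Step (fst (pair M N)) M
  | snd_pair {M N} : Step (snd (pair M N)) N
  | ite_tt {Mt Mf} : Step (ite tt Mt Mf) Mt
  | ite_ff {Mt Mf} : Step (ite ff Mt Mf) Mf
  | ifze_ze {Mz Ms} : Step (ifze ze Mz Ms) Mz
  | ifze_su {M Mz Ms} : Step (ifze (su M) Mz Ms) (Ms.inst M)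
  | wrec_sup {M N O} : Step (wrec (sup M N) O)
      (O.inst₃ M (lam N) (lam (wrec N (O.rename (upRen (upRen (upRen Fin.elim0)))))))
  | fix {M} : Step (fix M) (M.inst (fix M))

theorem Val.res {U V : World} (f : V ⟶ U) {M : PreTm U 0} (h : Val M) : Val (M.res f) := by
  cases h <;> constructor

theorem Step.res {U V : World} (f : V ⟶ U) {M N : PreTm U 0} (hM : M.Natural) (h : Step M N) :
    Step (M.res f) (N.res f) := by
  induction h with
  | app _ ih => exact Step.app (ih hM.1)
  | kapp _ ih => exact Step.kapp (ih hM)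
  | fst _ ih => exact Step.fst (ih hM)
  | snd _ ih => exact Step.snd (ih hM)
  | ite _ ih => exact Step.ite (ih hM.1)
  | ifze _ ih => exact Step.ifze (ih hM.1)
  | wrec _ ih => exact Step.wrec (ih hM.1)
  | app_lam => rw [res_inst]; exact Step.app_lam
  | @kapp_klam F κ =>
    have e : (F U (𝟙 U) κ).res f = F V (𝟙 V ≫ f) (f.toFun κ) := by
      rw [hM.2]; simp
    rw [e]
    exact Step.kapp_klam (M := fun W g κ => F W (g ≫ f) κ)
  | fst_pair => exact Step.fst_pair
  | snd_pair => exact Step.snd_pair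
  | ite_tt => exact Step.ite_tt
  | ite_ff => exact Step.ite_ff
  | ifze_ze => exact Step.ifze_ze
  | ifze_su => rw [res_inst]; exact Step.ifze_su
  | wrec_sup =>
    rw [res_inst₃]
    simp only [PreTm.res, res_rename]
    exact Step.wrec_sup
  | fix => rw [res_inst]; exact Step.fix

end PreTm

/-- Elements at `U` of the object of programs with `n` free variables. -/
def TmAt (n : ℕ) (U : World) : Type := {t : PreTm U n // t.Natural}

namespace TmAt

variable {n : ℕ} {U V W : World}

@[ext]
theorem ext {M N : TmAt n U} (h : M.1 = N.1) : M = N := Subtype.ext h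

/-- Restriction of programs. -/
def restrict (M : TmAt n U) (f : V ⟶ U) : TmAt n V := ⟨M.1.res f, M.2.res f⟩

theorem restrict_id (M : TmAt n U) : M.restrict (𝟙 U) = M := ext (PreTm.res_id _)

theorem restrict_restrict (M : TmAt n U) (f : V ⟶ U) (g : W ⟶ V) :
    (M.restrict f).restrict g = M.restrict (g ≫ f) := ext (PreTm.res_res _ _ _)

end TmAt

/-- The object of programs with `n` free variables: the inductive family, internal to the topos,
generated by the program constructors. -/
abbrev Tm (n : ℕ) : ClkTopos where
  obj U := TmAt n U.unop
  map f := ↾fun M => M.restrict f.unop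
  map_id U := by
    ext M
    exact congrArg Subtype.val (TmAt.restrict_id M)
  map_comp f g := by
    ext M
    exact congrArg Subtype.val (TmAt.restrict_restrict M f.unop g.unop).symm

/-- Clock-indexed families of programs: elements of the exponential of `Tm n` by `Clk`. -/
abbrev ClkFam (n : ℕ) (U : World) : Type := ExpAt Clk (Tm n) U

namespace TmAt

variable {n : ℕ} {U V W : World}

/-- `M(N)`. -/
def app (M N : TmAt n U) : TmAt n U := ⟨.app M.1 N.1, M.2, N.2⟩
/-- `M(κ)`. -/
def kapp (M : TmAt n U) (κ : Fin U.card) : TmAt n U := ⟨.kapp M.1 κ, M.2⟩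
/-- First projection. -/
def fst (M : TmAt n U) : TmAt n U := ⟨.fst M.1, M.2⟩
/-- Second projection. -/
def snd (M : TmAt n U) : TmAt n U := ⟨.snd M.1, M.2⟩
/-- The canonical element of the unit type and of true equality types. -/
def star : TmAt n U := ⟨.star, trivial⟩
/-- The boolean `true`. -/
def tt : TmAt n U := ⟨.tt, trivial⟩
/-- The boolean `false`. -/
def ff : TmAt n U := ⟨.ff, trivial⟩
/-- Zero. -/
def ze : TmAt n U := ⟨.ze, trivial⟩
/-- Successor. -/
def su (M : TmAt n U) : TmAt n U := ⟨.su M.1, M.2⟩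
/-- `sup(M, x.N)`. -/
def sup (M : TmAt n U) (N : TmAt (n + 1) U) : TmAt n U := ⟨.sup M.1 N.1, M.2, N.2⟩
/-- Dependent function type. -/
def pi (A : TmAt n U) (B : TmAt (n + 1) U) : TmAt n U := ⟨.pi A.1 B.1, A.2, B.2⟩
/-- Dependent pair type. -/
def sg (A : TmAt n U) (B : TmAt (n + 1) U) : TmAt n U := ⟨.sg A.1 B.1, A.2, B.2⟩
/-- Type of well-orderings. -/
def wty (A : TmAt n U) (B : TmAt (n + 1) U) : TmAt n U := ⟨.wty A.1 B.1, A.2, B.2⟩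
/-- Equality type. -/
def eq (A M N : TmAt n U) : TmAt n U := ⟨.eq A.1 M.1 N.1, A.2, M.2, N.2⟩
/-- Later modality. -/
def ltr (κ : Fin U.card) (A : TmAt n U) : TmAt n U := ⟨.ltr κ A.1, A.2⟩
/-- Clock intersection. -/
def isect (A : ClkFam n U) : TmAt n U :=
  ⟨.isect fun _ f κ => (A.app f κ).1, fun _ f κ => (A.app f κ).2,
    fun _ _ f g κ => congrArg Subtype.val (A.natural f g κ)⟩
/-- Clock product. -/
def kprod (A : ClkFam n U) : TmAt n U :=
  ⟨.kprod fun _ f κ => (A.app f κ).1, fun _ f κ => (A.app f κ).2,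
    fun _ _ f g κ => congrArg Subtype.val (A.natural f g κ)⟩
/-- Empty type. -/
def void : TmAt n U := ⟨.void, trivial⟩
/-- Unit type. -/
def unit : TmAt n U := ⟨.unit, trivial⟩
/-- Type of booleans. -/
def bool : TmAt n U := ⟨.bool, trivial⟩
/-- Type of natural numbers. -/
def nat : TmAt n U := ⟨.nat, trivial⟩
/-- Universes. -/
def univ (i : ℕ) : TmAt n U := ⟨.univ i, trivial⟩
/-- Substitution of a closed program for the only variable. -/
def inst (B : TmAt 1 U) (M : TmAt 0 U) : TmAt 0 U :=
  ⟨B.1.inst M.1, PreTm.Natural.subst (fun _ => M.2) B.2⟩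

theorem restrict_inst (B : TmAt 1 U) (M : TmAt 0 U) (f : V ⟶ U) :
    (B.inst M).restrict f = (B.restrict f).inst (M.restrict f) := ext (PreTm.res_inst f _ _)

/-- Values. -/
def Val (M : TmAt 0 U) : Prop := M.1.Val

/-- The transition relation. -/
def Step (M N : TmAt 0 U) : Prop := M.1.Step N.1

/-- The reflexive-transitive closure of the transition relation. -/
def StepStar : TmAt 0 U → TmAt 0 U → Prop := Relation.ReflTransGen Step

/-- `M` evaluates to the value `v`. -/
def Evals (M v : TmAt 0 U) : Prop := StepStar M v ∧ Val v

theorem StepStar.restrict {M N : TmAt 0 U} (h : StepStar M N) (f : V ⟶ U) :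
    StepStar (M.restrict f) (N.restrict f) := by
  induction h with
  | refl => exact Relation.ReflTransGen.refl
  | @tail N P _ hs ih => exact ih.tail (PreTm.Step.res f N.2 hs)

theorem Evals.restrict {M v : TmAt 0 U} (h : Evals M v) (f : V ⟶ U) :
    Evals (M.restrict f) (v.restrict f) :=
  ⟨h.1.restrict f, PreTm.Val.res f h.2⟩

/-- Closed approximation at `U`: for every value `v`, if `M` evaluates to `v` then so does `N`. -/
def Approx (M N : TmAt 0 U) : Prop :=
  ∀ ⦃V : World⦄ (f : V ⟶ U) (v : TmAt 0 V), v.Val →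
    StepStar (M.restrict f) v → StepStar (N.restrict f) v

end TmAt

/-! ## Relations and candidate type systems -/

/-- The object of relations on closed programs. -/
abbrev Rel : ClkTopos := Pow (FunctorToTypes.prod (Tm 0) (Tm 0))

/-- Relations on closed programs at a world. -/
abbrev RelAt (U : World) : Type := PowAt (FunctorToTypes.prod (Tm 0) (Tm 0)) U

/-- The object of candidate type systems. -/
abbrev PTS : ClkTopos := Pow (FunctorToTypes.prod (Tm 0) Rel)

/-- Candidate type systems at a world. -/
abbrev PTSAt (U : World) : Type := PowAt (FunctorToTypes.prod (Tm 0) Rel) U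

/-- Families of relations indexed by closed programs. -/
abbrev TmRelFam (U : World) : Type := ExpAt (Tm 0) Rel U

/-- Families of relations indexed by clocks. -/
abbrev ClkRelFam (U : World) : Type := ExpAt Clk Rel U

/-- Restriction of elements of exponentials. -/
def ExpAt.restrict {X Y : ClkTopos} {U V : World} (h : ExpAt X Y U) (f : V ⟶ U) : ExpAt X Y V :=
  res (X := Exp X Y) h f

/-- `(M, N)` belongs to the restriction of `R` along `f`. -/
def RelAt.Mem {U V : World} (R : RelAt U) (f : V ⟶ U) (M N : TmAt 0 V) : Prop := R.mem f (M, N)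

/-- `(M, N) ∈ R`. -/
def RelAt.Rel {U : World} (R : RelAt U) (M N : TmAt 0 U) : Prop := RelAt.Mem R (𝟙 U) M N

/-- `(A, R)` belongs to the restriction of `τ` along `f`. -/
def PTSAt.Mem {U V : World} (τ : PTSAt U) (f : V ⟶ U) (A : TmAt 0 V) (R : RelAt V) : Prop :=
  τ.mem f (A, R)

theorem RelAt.Mem.res {U V W : World} {R : RelAt U} {f : V ⟶ U} {M N : TmAt 0 V}
    (h : RelAt.Mem R f M N) (g : W ⟶ V) :
    RelAt.Mem R (g ≫ f) (M.restrict g) (N.restrict g) := R.mono f g (M, N) h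

theorem RelAt.Rel.res {U V : World} {R : RelAt U} {M N : TmAt 0 U} (h : RelAt.Rel R M N)
    (g : V ⟶ U) : RelAt.Rel (R.restrict g) (M.restrict g) (N.restrict g) := by
  have := RelAt.Mem.res h g
  change R.mem (𝟙 V ≫ g) _
  rw [Category.id_comp]
  rwa [RelAt.Mem, Category.comp_id] at this

theorem PTSAt.Mem.res {U V W : World} {τ : PTSAt U} {f : V ⟶ U} {A : TmAt 0 V} {R : RelAt V}
    (h : PTSAt.Mem τ f A R) (g : W ⟶ V) :
    PTSAt.Mem τ (g ≫ f) (A.restrict g) (R.restrict g) := τ.mono f g (A, R) h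

/-- Comprehension for relations. -/
def RelAt.mk {U : World} (φ : ∀ ⦃V : World⦄, (V ⟶ U) → TmAt 0 V → TmAt 0 V → Prop)
    (hφ : ∀ ⦃V W : World⦄ (f : V ⟶ U) (g : W ⟶ V) (M N : TmAt 0 V), φ f M N →
      φ (g ≫ f) (M.restrict g) (N.restrict g)) : RelAt U where
  mem _ f p := φ f p.1 p.2
  mono _ _ f g p := hφ f g p.1 p.2

/-- Comprehension for candidate type systems. -/
def PTSAt.mk {U : World} (φ : ∀ ⦃V : World⦄, (V ⟶ U) → TmAt 0 V → RelAt V → Prop)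
    (hφ : ∀ ⦃V W : World⦄ (f : V ⟶ U) (g : W ⟶ V) (A : TmAt 0 V) (R : RelAt V), φ f A R →
      φ (g ≫ f) (A.restrict g) (R.restrict g)) : PTSAt U where
  mem _ f p := φ f p.1 p.2
  mono _ _ f g p := hφ f g p.1 p.2

/-! ### Type systems -/

/-- `R` is a computational partial equivalence relation, at the world `U`. -/
structure IsCPER {U : World} (R : RelAt U) : Prop where
  symm : ∀ ⦃V : World⦄ (f : V ⟶ U) (M N : TmAt 0 V), RelAt.Mem R f M N → RelAt.Mem R f N M
  trans : ∀ ⦃V : World⦄ (f : V ⟶ U) (M N P : TmAt 0 V),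
    RelAt.Mem R f M N → RelAt.Mem R f N P → RelAt.Mem R f M P
  computational : ∀ ⦃V : World⦄ (f : V ⟶ U) (M M' N : TmAt 0 V),
    RelAt.Mem R f M N → M.Approx M' → RelAt.Mem R f M' N

/-- `τ` is the graph of a partial function from closed programs to relations. -/
def IsExtensional {U : World} (τ : PTSAt U) : Prop :=
  ∀ ⦃V : World⦄ (f : V ⟶ U) (A : TmAt 0 V) (R S : RelAt V),
    PTSAt.Mem τ f A R → PTSAt.Mem τ f A S → R = S

/-- `τ` is computational-PER-valued. -/
def IsCPERValued {U : World} (τ : PTSAt U) : Prop :=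
  ∀ ⦃V : World⦄ (f : V ⟶ U) (A : TmAt 0 V) (R : RelAt V), PTSAt.Mem τ f A R → IsCPER R

/-- `τ` is type-computational. -/
def IsTypeComputational {U : World} (τ : PTSAt U) : Prop :=
  ∀ ⦃V : World⦄ (f : V ⟶ U) (A A' : TmAt 0 V) (R : RelAt V),
    PTSAt.Mem τ f A R → A.Approx A' → PTSAt.Mem τ f A' R

/-- `τ` is a type system, at the world `U`. -/
structure IsTypeSystem {U : World} (τ : PTSAt U) : Prop where
  extensional : IsExtensional τ
  cperValued : IsCPERValued τ
  typeComputational : IsTypeComputational τ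

/-- Similarity of types: `A` and `B` have a common value in `τ`. -/
def SimType {U V : World} (τ : PTSAt U) (f : V ⟶ U) (A B : TmAt 0 V) : Prop :=
  ∃ R : RelAt V, PTSAt.Mem τ f A R ∧ PTSAt.Mem τ f B R

/-! ### Closure under evaluation -/

/-- Closure of a relation under evaluation to canonical form. -/
def RelAt.valClo {U : World} (R : RelAt U) : RelAt U :=
  RelAt.mk (fun _ f M N => ∃ v w, M.Evals v ∧ N.Evals w ∧ RelAt.Mem R f v w)
    fun _ _ _ g _ _ ⟨v, w, hv, hw, h⟩ =>
      ⟨v.restrict g, w.restrict g, hv.restrict g, hw.restrict g, h.res g⟩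

/-- Closure of a candidate type system under evaluation to canonical form. -/
def PTSAt.valClo {U : World} (τ : PTSAt U) : PTSAt U :=
  PTSAt.mk (fun _ f A R => ∃ v, A.Evals v ∧ PTSAt.Mem τ f v R)
    fun _ _ _ g _ _ ⟨v, hv, h⟩ => ⟨v.restrict g, hv.restrict g, h.res g⟩

theorem RelAt.valClo_mono {U : World} {R S : RelAt U} (h : R ≤ S) :
    RelAt.valClo R ≤ RelAt.valClo S :=
  fun _ f _ ⟨v, w, hv, hw, hR⟩ => ⟨v, w, hv, hw, h f (v, w) hR⟩

theorem PTSAt.valClo_mono {U : World} {τ τ' : PTSAt U} (h : τ ≤ τ') :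
    PTSAt.valClo τ ≤ PTSAt.valClo τ' :=
  fun _ f p ⟨v, hv, hR⟩ => ⟨v, hv, h f (v, p.2) hR⟩

theorem RelAt.valClo_restrict {U V : World} (R : RelAt U) (f : V ⟶ U) :
    (RelAt.valClo R).restrict f = RelAt.valClo (R.restrict f) := rfl

theorem PTSAt.valClo_restrict {U V : World} (τ : PTSAt U) (f : V ⟶ U) :
    (PTSAt.valClo τ).restrict f = PTSAt.valClo (τ.restrict f) := rfl

/-! ## The relations of the individual connectives -/

section Relations

variable {U V : World}

/-- `{(⋆, ⋆)}`. -/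
def unitRel (U : World) : RelAt U :=
  RelAt.mk (fun _ _ M N => M = .star ∧ N = .star) fun _ _ _ _ _ _ ⟨h, h'⟩ => by
    subst h h'
    exact ⟨rfl, rfl⟩

/-- `{(tt, tt), (ff, ff)}`. -/
def boolRel (U : World) : RelAt U :=
  RelAt.mk (fun _ _ M N => (M = .tt ∧ N = .tt) ∨ (M = .ff ∧ N = .ff))
    fun _ _ _ _ _ _ h => by
      rcases h with ⟨h, h'⟩ | ⟨h, h'⟩ <;> subst h h'
      · exact Or.inl ⟨rfl, rfl⟩
      · exact Or.inr ⟨rfl, rfl⟩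

/-- The operator `Y ↦ {(ze, ze)} ∪ {(su M₀, su M₁) | (M₀, M₁) ∈ Y⇓}`. -/
def natOp (U : World) : RelAt U →o RelAt U where
  toFun Y := RelAt.mk (fun _ f M N => (M = .ze ∧ N = .ze) ∨
      ∃ M₀ M₁ : TmAt 0 _, M = .su M₀ ∧ N = .su M₁ ∧ RelAt.Mem (RelAt.valClo Y) f M₀ M₁)
    fun _ _ _ g _ _ h => by
      rcases h with ⟨h, h'⟩ | ⟨M₀, M₁, h, h', hY⟩ <;> subst h h'
      · exact Or.inl ⟨rfl, rfl⟩
      · exact Or.inr ⟨M₀.restrict g, M₁.restrict g, rfl, rfl, hY.res g⟩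
  monotone' _ _ hY _ f _ := Or.imp id fun ⟨M₀, M₁, h, h', hm⟩ =>
    ⟨M₀, M₁, h, h', RelAt.valClo_mono hY f (M₀, M₁) hm⟩

/-- Equality of natural numbers in canonical form. -/
def natRel (U : World) : RelAt U := (natOp U).lfp

/-- Similarity of elements of dependent pair types. -/
def sgRel (𝒜 : RelAt U) (ℬ : TmRelFam U) : RelAt U :=
  RelAt.mk (fun _ f M₀ M₁ => RelAt.Mem 𝒜 f M₀.fst M₁.fst ∧
      RelAt.Rel (ℬ.app f M₀.fst) M₀.snd M₁.snd)
    fun V W f g M₀ M₁ h => by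
      refine ⟨h.1.res g, ?_⟩
      change RelAt.Rel (ℬ.app (g ≫ f) (res (X := Tm 0) M₀.fst g)) _ _
      rw [← ℬ.natural f g M₀.fst]
      exact h.2.res g

/-- Similarity of elements of dependent function types. -/
def piRel (𝒜 : RelAt U) (ℬ : TmRelFam U) : RelAt U :=
  RelAt.mk (fun V f M₀ M₁ => ∀ ⦃W : World⦄ (g : W ⟶ V) (N₀ N₁ : TmAt 0 W),
      RelAt.Mem 𝒜 (g ≫ f) N₀ N₁ →
        RelAt.Rel (ℬ.app (g ≫ f) N₀) ((M₀.restrict g).app N₀) ((M₁.restrict g).app N₁))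
    fun V W f g M₀ M₁ h W' k N₀ N₁ hN => by
      have := h (k ≫ g) N₀ N₁ (by rwa [Category.assoc])
      simpa only [Category.assoc, TmAt.restrict_restrict] using this

/-- The operator whose least fixed point is similarity of canonical elements of a type of
well-orderings. -/
def wOp (𝒜 : RelAt U) (ℬ : TmRelFam U) : RelAt U →o RelAt U where
  toFun Y := RelAt.mk (fun V f M N => ∃ (M₀ M₁ : TmAt 0 V) (N₀ N₁ : TmAt 1 V),
      M = .sup M₀ N₀ ∧ N = .sup M₁ N₁ ∧ RelAt.Mem 𝒜 f M₀ M₁ ∧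
      ∀ ⦃W : World⦄ (g : W ⟶ V) (O₀ O₁ : TmAt 0 W), RelAt.Mem (ℬ.app f M₀) g O₀ O₁ →
        RelAt.Mem (RelAt.valClo Y) (g ≫ f) ((N₀.restrict g).inst O₀) ((N₁.restrict g).inst O₁))
    fun V W f g _ _ ⟨M₀, M₁, N₀, N₁, h, h', h𝒜, hY⟩ => by
      subst h h'
      refine ⟨M₀.restrict g, M₁.restrict g, N₀.restrict g, N₁.restrict g, rfl, rfl, h𝒜.res g, ?_⟩
      intro W' k O₀ O₁ hO
      have e := ℬ.natural f g M₀
      change RelAt.Mem (ℬ.app (g ≫ f) (res (X := Tm 0) M₀ g)) k O₀ O₁ at hO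
      rw [← e] at hO
      have := hY (k ≫ g) O₀ O₁ hO
      simpa only [Category.assoc, TmAt.restrict_restrict] using this
  monotone' _ _ hY _ f _ := fun ⟨M₀, M₁, N₀, N₁, h, h', h𝒜, hm⟩ =>
    ⟨M₀, M₁, N₀, N₁, h, h', h𝒜, fun _ g O₀ O₁ hO => RelAt.valClo_mono hY (g ≫ f) _ (hm g O₀ O₁ hO)⟩

/-- Similarity of canonical elements of types of well-orderings. -/
def wRel (𝒜 : RelAt U) (ℬ : TmRelFam U) : RelAt U := (wOp 𝒜 ℬ).lfp

/-- `{(⋆, ⋆) | (M₀, M₁) ∈ 𝒜}`. -/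
def eqRel (𝒜 : RelAt U) (M₀ M₁ : TmAt 0 U) : RelAt U :=
  RelAt.mk (fun _ f M N => M = .star ∧ N = .star ∧
      RelAt.Mem 𝒜 f (M₀.restrict f) (M₁.restrict f))
    fun _ _ f g _ _ ⟨h, h', hm⟩ => by
      subst h h'
      refine ⟨rfl, rfl, ?_⟩
      simpa only [TmAt.restrict_restrict] using hm.res g

/-- `{(M₀, M₁) | ▷κ ((M₀, M₁) ∈ 𝒜)}`. -/
def ltrRel (κ : Fin U.card) (𝒜 : RelAt U) : RelAt U :=
  RelAt.mk (fun _ f M₀ M₁ => Later (f.toFun κ) fun _ g =>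
      RelAt.Mem 𝒜 (g ≫ f) (M₀.restrict g) (M₁.restrict g))
    fun V W f g M₀ M₁ h => by
      have := Later.mono (fun V' W' k l hk => by
        simpa only [Category.assoc, TmAt.restrict_restrict] using RelAt.Mem.res hk l) g h
      simpa only [Category.assoc, TmAt.restrict_restrict, World.comp_toFun] using this

/-- `{(M₀, M₁) | ∀ κ, (M₀, M₁) ∈ 𝒜(κ)}`. -/
def isectRel (𝒜 : ClkRelFam U) : RelAt U :=
  RelAt.mk (fun V f M₀ M₁ => ∀ ⦃W : World⦄ (g : W ⟶ V) (κ : Fin W.card),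
      RelAt.Rel (𝒜.app (g ≫ f) κ) (M₀.restrict g) (M₁.restrict g))
    fun V W f g M₀ M₁ h W' k κ => by
      simpa only [Category.assoc, TmAt.restrict_restrict] using h (k ≫ g) κ

/-- `{(M₀, M₁) | ∀ κ, (M₀(κ), M₁(κ)) ∈ 𝒜(κ)}`. -/
def kprodRel (𝒜 : ClkRelFam U) : RelAt U :=
  RelAt.mk (fun V f M₀ M₁ => ∀ ⦃W : World⦄ (g : W ⟶ V) (κ : Fin W.card),
      RelAt.Rel (𝒜.app (g ≫ f) κ) ((M₀.restrict g).kapp κ) ((M₁.restrict g).kapp κ))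
    fun V W f g M₀ M₁ h W' k κ => by
      simpa only [Category.assoc, TmAt.restrict_restrict] using h (k ≫ g) κ

end Relations

section Reindexing

variable {U V : World} (f : V ⟶ U)

theorem unitRel_restrict : (unitRel U).restrict f = unitRel V := rfl

theorem boolRel_restrict : (boolRel U).restrict f = boolRel V := rfl

theorem natRel_restrict : (natRel U).restrict f = natRel V :=
  PowAt.restrict_lfp f _ _ fun _ => rfl

theorem sgRel_restrict (𝒜 : RelAt U) (ℬ : TmRelFam U) :
    (sgRel 𝒜 ℬ).restrict f = sgRel (𝒜.restrict f) (ℬ.restrict f) := rfl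

theorem piRel_restrict (𝒜 : RelAt U) (ℬ : TmRelFam U) :
    (piRel 𝒜 ℬ).restrict f = piRel (𝒜.restrict f) (ℬ.restrict f) := by
  apply PowAt.ext
  funext W g p
  simp only [PowAt.restrict, ExpAt.restrict, piRel, RelAt.mk, RelAt.Mem]
  simp [res]

theorem wRel_restrict (𝒜 : RelAt U) (ℬ : TmRelFam U) :
    (wRel 𝒜 ℬ).restrict f = wRel (𝒜.restrict f) (ℬ.restrict f) := by
  refine PowAt.restrict_lfp f _ _ fun Y => ?_
  apply PowAt.ext
  funext W g p
  simp only [PowAt.restrict, ExpAt.restrict, wOp, RelAt.mk, RelAt.Mem, RelAt.valClo]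
  simp [res]

theorem eqRel_restrict (𝒜 : RelAt U) (M₀ M₁ : TmAt 0 U) :
    (eqRel 𝒜 M₀ M₁).restrict f = eqRel (𝒜.restrict f) (M₀.restrict f) (M₁.restrict f) := by
  apply PowAt.ext
  funext W g p
  simp only [eqRel, RelAt.mk, RelAt.Mem, TmAt.restrict_restrict]
  rfl

theorem ltrRel_restrict (κ : Fin U.card) (𝒜 : RelAt U) :
    (ltrRel κ 𝒜).restrict f = ltrRel (f.toFun κ) (𝒜.restrict f) := by
  apply PowAt.ext
  funext W g p
  simp only [PowAt.restrict, ltrRel, RelAt.mk, RelAt.Mem]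
  simp [res, World.comp_toFun]

theorem isectRel_restrict (𝒜 : ClkRelFam U) :
    (isectRel 𝒜).restrict f = isectRel (𝒜.restrict f) := by
  apply PowAt.ext
  funext W g p
  simp only [PowAt.restrict, ExpAt.restrict, isectRel, RelAt.mk]
  simp [res]

theorem kprodRel_restrict (𝒜 : ClkRelFam U) :
    (kprodRel 𝒜).restrict f = kprodRel (𝒜.restrict f) := by
  apply PowAt.ext
  funext W g p
  simp only [PowAt.restrict, ExpAt.restrict, kprodRel, RelAt.mk]
  simp [res]

end Reindexing

/-! ## The monotone operator on candidate type systems -/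

/-- A monotone operator on candidate type systems in the topos, given by the condition for a pair
`(A, 𝒳)` to belong to its value at `τ`. -/
structure Clause where
  holds : ∀ ⦃U : World⦄, PTSAt U → TmAt 0 U → RelAt U → Prop
  mono : ∀ ⦃U : World⦄ (τ τ' : PTSAt U) (A : TmAt 0 U) (R : RelAt U), τ ≤ τ' →
    holds τ A R → holds τ' A R
  restrict : ∀ ⦃U V : World⦄ (f : V ⟶ U) (τ : PTSAt U) (A : TmAt 0 U) (R : RelAt U),
    holds τ A R → holds (τ.restrict f) (A.restrict f) (R.restrict f)

/-- The operator given by a clause. -/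
def Clause.op (c : Clause) (U : World) : PTSAt U →o PTSAt U where
  toFun τ := PTSAt.mk (fun _ f A R => c.holds (τ.restrict f) A R) fun _ _ f g A R h => by
    simpa [PowAt.restrict, res] using c.restrict g _ A R h
  monotone' _ _ h _ f _ := c.mono _ _ _ _ (PowAt.restrict_mono h f)

theorem Clause.op_restrict (c : Clause) {U V : World} (f : V ⟶ U) (τ : PTSAt U) :
    (c.op U τ).restrict f = c.op V (τ.restrict f) := by
  apply PowAt.ext
  funext W g p
  simp only [PowAt.restrict, Clause.op, PTSAt.mk]
  simp [res]

/-- `A ∈ τ` has value `𝒜`, and `B` is a family of types over `𝒜`, with values given by `ℬ`. -/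
structure IsFam {U : World} (τ : PTSAt U) (A : TmAt 0 U) (B : TmAt 1 U) (𝒜 : RelAt U)
    (ℬ : TmRelFam U) : Prop where
  base : PTSAt.Mem τ (𝟙 U) A 𝒜
  fam : ∀ ⦃V : World⦄ (f : V ⟶ U) (M₀ M₁ : TmAt 0 V), RelAt.Mem 𝒜 f M₀ M₁ →
    PTSAt.Mem τ f ((B.restrict f).inst M₀) (ℬ.app f M₀) ∧
    PTSAt.Mem τ f ((B.restrict f).inst M₁) (ℬ.app f M₀) ∧
    PTSAt.Mem τ f ((B.restrict f).inst M₁) (ℬ.app f M₁) ∧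
    PTSAt.Mem τ f ((B.restrict f).inst M₀) (ℬ.app f M₁)

theorem PTSAt.Mem.restrict {U V : World} {τ : PTSAt U} {A : TmAt 0 U} {R : RelAt U}
    (h : PTSAt.Mem τ (𝟙 U) A R) (f : V ⟶ U) :
    PTSAt.Mem (τ.restrict f) (𝟙 V) (A.restrict f) (R.restrict f) := by
  have := PTSAt.Mem.res h f
  change τ.mem (𝟙 V ≫ f) _
  rw [Category.id_comp]
  rwa [PTSAt.Mem, Category.comp_id] at this

theorem IsFam.mono {U : World} {τ τ' : PTSAt U} {A : TmAt 0 U} {B : TmAt 1 U} {𝒜 : RelAt U}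
    {ℬ : TmRelFam U} (hτ : τ ≤ τ') (h : IsFam τ A B 𝒜 ℬ) : IsFam τ' A B 𝒜 ℬ where
  base := hτ _ _ h.base
  fam _ f M₀ M₁ hM := by
    obtain ⟨h1, h2, h3, h4⟩ := h.fam f M₀ M₁ hM
    exact ⟨hτ _ _ h1, hτ _ _ h2, hτ _ _ h3, hτ _ _ h4⟩

theorem IsFam.restrict {U V : World} {τ : PTSAt U} {A : TmAt 0 U} {B : TmAt 1 U} {𝒜 : RelAt U}
    {ℬ : TmRelFam U} (h : IsFam τ A B 𝒜 ℬ) (f : V ⟶ U) :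
    IsFam (τ.restrict f) (A.restrict f) (B.restrict f) (𝒜.restrict f) (ℬ.restrict f) where
  base := PTSAt.Mem.restrict h.base f
  fam _ g M₀ M₁ hM := by
    simp only [TmAt.restrict_restrict]
    exact h.fam (g ≫ f) M₀ M₁ hM

/-- Empty type. -/
def clVoid : Clause where
  holds _ _ A X := A = .void ∧ X = ⊥
  mono _ _ _ _ _ _ h := h
  restrict _ _ _ _ _ _ := fun ⟨h, h'⟩ => by subst h h'; exact ⟨rfl, rfl⟩

/-- Unit type. -/
def clUnit : Clause where
  holds U _ A X := A = .unit ∧ X = RelAt.valClo (unitRel U)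
  mono _ _ _ _ _ _ h := h
  restrict _ _ _ _ _ _ := fun ⟨h, h'⟩ => by subst h h'; exact ⟨rfl, rfl⟩

/-- Booleans. -/
def clBool : Clause where
  holds U _ A X := A = .bool ∧ X = RelAt.valClo (boolRel U)
  mono _ _ _ _ _ _ h := h
  restrict _ _ _ _ _ _ := fun ⟨h, h'⟩ => by subst h h'; exact ⟨rfl, rfl⟩

/-- Natural numbers. -/
def clNat : Clause where
  holds U _ A X := A = .nat ∧ X = RelAt.valClo (natRel U)
  mono _ _ _ _ _ _ h := h
  restrict _ _ f _ _ _ := fun ⟨h, h'⟩ => by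
    subst h h'
    exact ⟨rfl, by rw [RelAt.valClo_restrict, natRel_restrict]⟩

/-- Dependent pair types. -/
def clSg : Clause where
  holds _ τ C X := ∃ A B, C = .sg A B ∧ ∃ 𝒜 ℬ, IsFam τ A B 𝒜 ℬ ∧ X = sgRel 𝒜 ℬ
  mono _ _ _ _ _ hτ := fun ⟨A, B, h, 𝒜, ℬ, hF, h'⟩ => ⟨A, B, h, 𝒜, ℬ, hF.mono hτ, h'⟩
  restrict _ _ f _ _ _ := fun ⟨A, B, h, 𝒜, ℬ, hF, h'⟩ => by
    subst h h'
    exact ⟨A.restrict f, B.restrict f, rfl, 𝒜.restrict f, ℬ.restrict f, hF.restrict f,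
      sgRel_restrict f 𝒜 ℬ⟩

/-- Dependent function types. -/
def clPi : Clause where
  holds _ τ C X := ∃ A B, C = .pi A B ∧ ∃ 𝒜 ℬ, IsFam τ A B 𝒜 ℬ ∧ X = piRel 𝒜 ℬ
  mono _ _ _ _ _ hτ := fun ⟨A, B, h, 𝒜, ℬ, hF, h'⟩ => ⟨A, B, h, 𝒜, ℬ, hF.mono hτ, h'⟩
  restrict _ _ f _ _ _ := fun ⟨A, B, h, 𝒜, ℬ, hF, h'⟩ => by
    subst h h'
    exact ⟨A.restrict f, B.restrict f, rfl, 𝒜.restrict f, ℬ.restrict f, hF.restrict f,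
      piRel_restrict f 𝒜 ℬ⟩

/-- Types of well-orderings. -/
def clW : Clause where
  holds _ τ C X := ∃ A B, C = .wty A B ∧ ∃ 𝒜 ℬ, IsFam τ A B 𝒜 ℬ ∧
    X = RelAt.valClo (wRel 𝒜 ℬ)
  mono _ _ _ _ _ hτ := fun ⟨A, B, h, 𝒜, ℬ, hF, h'⟩ => ⟨A, B, h, 𝒜, ℬ, hF.mono hτ, h'⟩
  restrict _ _ f _ _ _ := fun ⟨A, B, h, 𝒜, ℬ, hF, h'⟩ => by
    subst h h'
    exact ⟨A.restrict f, B.restrict f, rfl, 𝒜.restrict f, ℬ.restrict f, hF.restrict f,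
      by rw [RelAt.valClo_restrict, wRel_restrict]⟩

/-- Equality types. -/
def clEq : Clause where
  holds U τ C X := ∃ A M₀ M₁, C = .eq A M₀ M₁ ∧ ∃ 𝒜, PTSAt.Mem τ (𝟙 U) A 𝒜 ∧
    RelAt.Rel 𝒜 M₀ M₀ ∧ RelAt.Rel 𝒜 M₁ M₁ ∧ X = RelAt.valClo (eqRel 𝒜 M₀ M₁)
  mono _ _ _ _ _ hτ := fun ⟨A, M₀, M₁, h, 𝒜, hA, h0, h1, h'⟩ =>
    ⟨A, M₀, M₁, h, 𝒜, hτ _ _ hA, h0, h1, h'⟩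
  restrict _ _ f _ _ _ := fun ⟨A, M₀, M₁, h, 𝒜, hA, h0, h1, h'⟩ => by
    subst h h'
    exact ⟨A.restrict f, M₀.restrict f, M₁.restrict f, rfl, 𝒜.restrict f,
      PTSAt.Mem.restrict hA f, h0.res f, h1.res f, by
        rw [RelAt.valClo_restrict, eqRel_restrict]⟩

/-- Later modalities: the argument is only required to be a type later. -/
def clLtr : Clause where
  holds U τ C X := ∃ (κ : Fin U.card) (A : TmAt 0 U), C = .ltr κ A ∧ ∃ 𝒜 : RelAt U,
    Later κ (fun _ f => PTSAt.Mem τ f (A.restrict f) (𝒜.restrict f)) ∧ X = ltrRel κ 𝒜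
  mono _ _ _ _ _ hτ := fun ⟨κ, A, h, 𝒜, hA, h'⟩ =>
    ⟨κ, A, h, 𝒜, hA.imp fun _ _ => hτ _ _, h'⟩
  restrict _ _ f τ _ _ := fun ⟨κ, A, h, 𝒜, hA, h'⟩ => by
    subst h h'
    refine ⟨f.toFun κ, A.restrict f, rfl, 𝒜.restrict f, ?_, ltrRel_restrict f κ 𝒜⟩
    have := Later.mono (fun V W k l hk => by
      simpa [TmAt.restrict_restrict, PowAt.restrict, res] using PTSAt.Mem.res hk l) f hA
    simpa [TmAt.restrict_restrict, PowAt.restrict, res, PTSAt.Mem] using this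

/-- Clock intersections. -/
def clIsect : Clause where
  holds U τ C X := ∃ A : ClkFam 0 U, C = .isect A ∧ ∃ 𝒜 : ClkRelFam U,
    (∀ ⦃V : World⦄ (f : V ⟶ U) (κ : Fin V.card), PTSAt.Mem τ f (A.app f κ) (𝒜.app f κ)) ∧
    X = isectRel 𝒜
  mono _ _ _ _ _ hτ := fun ⟨A, h, 𝒜, hA, h'⟩ => ⟨A, h, 𝒜, fun _ f κ => hτ _ _ (hA f κ), h'⟩
  restrict _ _ f _ _ _ := fun ⟨A, h, 𝒜, hA, h'⟩ => by
    subst h h'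
    exact ⟨A.restrict f, rfl, 𝒜.restrict f, fun _ g κ => hA (g ≫ f) κ, isectRel_restrict f 𝒜⟩

/-- Clock products. -/
def clKprod : Clause where
  holds U τ C X := ∃ A : ClkFam 0 U, C = .kprod A ∧ ∃ 𝒜 : ClkRelFam U,
    (∀ ⦃V : World⦄ (f : V ⟶ U) (κ : Fin V.card), PTSAt.Mem τ f (A.app f κ) (𝒜.app f κ)) ∧
    X = kprodRel 𝒜
  mono _ _ _ _ _ hτ := fun ⟨A, h, 𝒜, hA, h'⟩ => ⟨A, h, 𝒜, fun _ f κ => hτ _ _ (hA f κ), h'⟩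
  restrict _ _ f _ _ _ := fun ⟨A, h, 𝒜, hA, h'⟩ => by
    subst h h'
    exact ⟨A.restrict f, rfl, 𝒜.restrict f, fun _ g κ => hA (g ≫ f) κ, kprodRel_restrict f 𝒜⟩

/-- The union of the clauses of all the type formers other than universes. -/
def conns (U : World) : PTSAt U →o PTSAt U :=
  clVoid.op U ⊔ clUnit.op U ⊔ clBool.op U ⊔ clNat.op U ⊔ clSg.op U ⊔ clPi.op U ⊔ clKprod.op U ⊔
    clEq.op U ⊔ clLtr.op U ⊔ clIsect.op U ⊔ clW.op U

/-- The monotone operator that extends `σ` with all the connectives other than universes. -/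
def tsFun {U : World} (σ : PTSAt U) : PTSAt U →o PTSAt U where
  toFun τ := σ ⊔ PTSAt.valClo (conns U τ)
  monotone' _ _ h := sup_le_sup le_rfl (PTSAt.valClo_mono ((conns U).mono h))

/-- The closure of `σ`: the least fixed point of the operator `tsFun σ`. -/
def tsClose {U : World} (σ : PTSAt U) : PTSAt U := (tsFun σ).lfp

theorem PowAt.restrict_sup {X : ClkTopos} {U V : World} (f : V ⟶ U) (R S : PowAt X U) :
    (R ⊔ S).restrict f = R.restrict f ⊔ S.restrict f := rfl

theorem conns_restrict {U V : World} (f : V ⟶ U) (τ : PTSAt U) :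
    (conns U τ).restrict f = conns V (τ.restrict f) := by
  simp only [conns, OrderHom.coe_sup, Pi.sup_apply, PowAt.restrict_sup, Clause.op_restrict]

theorem tsFun_restrict {U V : World} (f : V ⟶ U) (σ τ : PTSAt U) :
    (tsFun σ τ).restrict f = tsFun (σ.restrict f) (τ.restrict f) := by
  change (σ ⊔ PTSAt.valClo (conns U τ)).restrict f = _
  rw [PowAt.restrict_sup, PTSAt.valClo_restrict, conns_restrict]
  rfl

/-- The closure operator commutes with restriction: it is a morphism `PTS ⟶ PTS` of the topos. -/
theorem tsClose_restrict {U V : World} (f : V ⟶ U) (σ : PTSAt U) :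
    (tsClose σ).restrict f = tsClose (σ.restrict f) :=
  PowAt.restrict_lfp f _ _ (tsFun_restrict f σ)

/-! ## The universe hierarchy -/

/-- Global elements of the object of candidate type systems: compatible families of candidate
type systems at all worlds. -/
abbrev GlobalPTS : Type := PTS.sections

/-- The value of a global candidate type system at a world. -/
def GlobalPTS.at (σ : GlobalPTS) (U : World) : PTSAt U := σ.1 (op U)

theorem GlobalPTS.at_restrict (σ : GlobalPTS) {U V : World} (f : V ⟶ U) :
    (GlobalPTS.at σ U).restrict f = GlobalPTS.at σ V := σ.2 f.op

/-- A compatible family of candidate type systems is a global one. -/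
def GlobalPTS.mk (τ : ∀ U, PTSAt U)
    (h : ∀ ⦃U V : World⦄ (f : V ⟶ U), (τ U).restrict f = τ V) : GlobalPTS :=
  ⟨fun U => τ U.unop, fun f => h f.unop⟩

/-- The closure of a global candidate type system. -/
def GlobalPTS.close (σ : GlobalPTS) : GlobalPTS :=
  GlobalPTS.mk (fun U => tsClose (GlobalPTS.at σ U)) fun U V f => by
    rw [tsClose_restrict, GlobalPTS.at_restrict]

/-- The relation `{(A₀, A₁) | τ ⊨ A₀ ∼ A₁}`. -/
def univRel {U : World} (τ : PTSAt U) : RelAt U :=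
  RelAt.mk (fun _ f A₀ A₁ => SimType τ f A₀ A₁) fun _ _ _ g _ _ ⟨R, h₀, h₁⟩ =>
    ⟨R.restrict g, h₀.res g, h₁.res g⟩

theorem univRel_restrict {U V : World} (f : V ⟶ U) (τ : PTSAt U) :
    (univRel τ).restrict f = univRel (τ.restrict f) := rfl

/-- The candidate type system `{(univ i, univRel τᵢ) | i ≤ n}⇓`. -/
def univLevel (n : ℕ) (τ : ∀ i, i ≤ n → GlobalPTS) : GlobalPTS :=
  GlobalPTS.mk (fun U => PTSAt.valClo (PTSAt.mk
      (fun V _ A R => ∃ (i : ℕ) (h : i ≤ n), A = .univ i ∧ R = univRel (GlobalPTS.at (τ i h) V))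
      fun V W f g A R ⟨i, hi, h, h'⟩ => ⟨i, hi, by subst h; rfl, by
        subst h'
        rw [univRel_restrict, GlobalPTS.at_restrict]⟩))
    fun _ _ _ => rfl

/-- The spine of the universe hierarchy, by complete recursion. -/
def spine : ℕ → GlobalPTS
  | 0 => GlobalPTS.mk (fun _ => ⊥) fun _ _ _ => rfl
  | n + 1 => univLevel n fun i _ => GlobalPTS.close (spine i)
  decreasing_by omega

/-- The `n`-th candidate type system of the hierarchy. -/
def tower (n : ℕ) : GlobalPTS := GlobalPTS.close (spine n)

/-- The join of the hierarchy. -/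
def tauOmega : GlobalPTS :=
  GlobalPTS.mk (fun U => ⨆ n, GlobalPTS.at (tower n) U) fun U V f => by
    apply PowAt.ext
    funext W g p
    apply propext
    change (∃ R ∈ Set.range _, _) ↔ (∃ R ∈ Set.range _, _)
    simp only [Set.exists_range_iff, ← GlobalPTS.at_restrict _ f, PowAt.mem_restrict]
    rfl

end GCTT

/-!
The proof is an induction on the level of the hierarchy, at all worlds at once. Each level is the
closure of the candidate type system `spine n`, all of whose types evaluate to universes, and the
levels increase with `n` (`tower_mono`). Since the three conditions on a type system only ever
compare finitely many members, the join of the levels is a type system as soon as each level is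
(`isTypeSystem_tower`). That `spine n` is a type system follows from the same fact for the lower
levels: for a type system `τ` the relation "`A₀` and `A₁` have a common value in `τ`" is a
computational partial equivalence relation (`isCPER_univRel`).

The main point is that the closure of such a `σ` is a type system. Type-computationality is
immediate from the fixed point equation. The other two conditions are proved by one induction on
the least fixed point `Cl` (`tsClose_le_determinedPart`): the pairs `(A, R)` of `Cl` for which `R`
is a computational partial equivalence relation, and the only value of `A` in `Cl` at every later
world, form a prefixed point. Evaluation is deterministic (`TmAt.Evals.unique`), so a type comes
either from `σ` or from the clause named by the head of its value, and it is enough to look at one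
clause at a time (`Clause.IsDeterminate`). In the clauses for `Σ`, `Π` and `W` the uniqueness of
values gives `ℬ(M₀) = ℬ(M₁)` for related `M₀` and `M₁` (`IsDetermined.isCPERFam`), which is what
symmetry and transitivity of the resulting relation require. In the clause for `▷κ` the relation
`𝒜` is determined only after a tick of `κ`, and the relation of the clause depends on nothing else
(`ltrRel_mem_iff`). Closure of the relations under approximation holds because elimination forms
evaluate their principal argument first, and hence respect approximation (`TmAt.IsFrame`).
-/

namespace GCTT

/-! ### Evaluation -/

namespace PreTm

theorem Val.not_step {U : World} {M N : PreTm U 0} (hM : M.Val) : ¬ M.Step N := by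
  intro h
  cases hM <;> cases h

theorem Step.deterministic {U : World} {M N P : PreTm U 0} (h : Step M N) (h' : Step M P) :
    N = P := by
  induction h generalizing P with
  | app hs ih =>
    cases h' with
    | app hs' => rw [ih hs']
    | app_lam => exact absurd hs (Val.lam _).not_step
  | kapp hs ih =>
    cases h' with
    | kapp hs' => rw [ih hs']
    | kapp_klam => exact absurd hs (Val.klam _).not_step
  | fst hs ih =>
    cases h' with
    | fst hs' => rw [ih hs']
    | fst_pair => exact absurd hs (Val.pair _ _).not_step
  | snd hs ih =>
    cases h' with
    | snd hs' => rw [ih hs']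
    | snd_pair => exact absurd hs (Val.pair _ _).not_step
  | ite hs ih =>
    cases h' with
    | ite hs' => rw [ih hs']
    | ite_tt => exact absurd hs Val.tt.not_step
    | ite_ff => exact absurd hs Val.ff.not_step
  | ifze hs ih =>
    cases h' with
    | ifze hs' => rw [ih hs']
    | ifze_ze => exact absurd hs Val.ze.not_step
    | ifze_su => exact absurd hs (Val.su _).not_step
  | wrec hs ih =>
    cases h' with
    | wrec hs' => rw [ih hs']
    | wrec_sup => exact absurd hs (Val.sup _ _).not_step
  | app_lam =>
    cases h' with
    | app hs' => exact absurd hs' (Val.lam _).not_step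
    | app_lam => rfl
  | kapp_klam =>
    cases h' with
    | kapp hs' => exact absurd hs' (Val.klam _).not_step
    | kapp_klam => rfl
  | fst_pair =>
    cases h' with
    | fst hs' => exact absurd hs' (Val.pair _ _).not_step
    | fst_pair => rfl
  | snd_pair =>
    cases h' with
    | snd hs' => exact absurd hs' (Val.pair _ _).not_step
    | snd_pair => rfl
  | ite_tt =>
    cases h' with
    | ite hs' => exact absurd hs' Val.tt.not_step
    | ite_tt => rfl
  | ite_ff =>
    cases h' with
    | ite hs' => exact absurd hs' Val.ff.not_step
    | ite_ff => rfl
  | ifze_ze =>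
    cases h' with
    | ifze hs' => exact absurd hs' Val.ze.not_step
    | ifze_ze => rfl
  | ifze_su =>
    cases h' with
    | ifze hs' => exact absurd hs' (Val.su _).not_step
    | ifze_su => rfl
  | wrec_sup =>
    cases h' with
    | wrec hs' => exact absurd hs' (Val.sup _ _).not_step
    | wrec_sup => rfl
  | fix => cases h'; rfl

end PreTm

namespace TmAt

variable {U V : World}

theorem Evals.unique {M v w : TmAt 0 U} (hv : M.Evals v) (hw : M.Evals w) : v = w := by
  obtain ⟨hv, Hv⟩ := hv
  obtain ⟨hw, Hw⟩ := hw
  induction hv using Relation.ReflTransGen.head_induction_on with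
  | refl =>
    rcases Relation.ReflTransGen.cases_head hw with h | ⟨P, hs, -⟩
    · exact h
    · exact absurd hs (PreTm.Val.not_step Hv)
  | head hs _ ih =>
    rcases Relation.ReflTransGen.cases_head hw with h | ⟨P, hs', hP⟩
    · subst h
      exact absurd hs (PreTm.Val.not_step Hw)
    · obtain rfl := TmAt.ext (PreTm.Step.deterministic hs hs')
      exact ih hP

theorem Val.evals {v : TmAt 0 U} (h : v.Val) : v.Evals v := ⟨Relation.ReflTransGen.refl, h⟩

theorem Approx.restrict {M N : TmAt 0 U} (h : M.Approx N) (f : V ⟶ U) :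
    (M.restrict f).Approx (N.restrict f) := by
  intro W g v hv hM
  rw [restrict_restrict] at hM ⊢
  exact h _ v hv hM

theorem Approx.evals {M N v : TmAt 0 U} (h : M.Approx N) (hM : M.Evals v) : N.Evals v := by
  refine ⟨?_, hM.2⟩
  have := h (𝟙 U) v hM.2
  rw [restrict_id, restrict_id] at this
  exact this hM.1

/-- `K` is an evaluation context of depth one: a program `K M` is evaluated by first evaluating
its principal argument `M`. -/
structure IsFrame (K : TmAt 0 U → TmAt 0 U) : Prop where
  step : ∀ {M M' : TmAt 0 U}, M.Step M' → (K M).Step (K M')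
  not_val : ∀ M : TmAt 0 U, ¬ (K M).Val
  step_inv : ∀ {M P : TmAt 0 U}, (K M).Step P → M.Val ∨ ∃ M', M.Step M' ∧ P = K M'

theorem IsFrame.stepStar {K : TmAt 0 U → TmAt 0 U} (hK : IsFrame K) {M M' : TmAt 0 U}
    (h : StepStar M M') : StepStar (K M) (K M') :=
  h.lift K fun _ _ => hK.step

theorem IsFrame.evals_arg {K : TmAt 0 U → TmAt 0 U} (hK : IsFrame K) {M v : TmAt 0 U}
    (h : (K M).Evals v) : ∃ w, M.Evals w ∧ StepStar (K w) v := by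
  obtain ⟨h, hv⟩ := h
  generalize hX : K M = X at h
  induction h using Relation.ReflTransGen.head_induction_on generalizing M with
  | refl =>
    subst hX
    exact absurd hv (hK.not_val M)
  | head hs h ih =>
    subst hX
    rcases hK.step_inv hs with hM | ⟨M', hs', rfl⟩
    · exact ⟨M, hM.evals, h.head hs⟩
    · obtain ⟨w, hw, h'⟩ := ih rfl
      exact ⟨w, ⟨hw.1.head hs', hw.2⟩, h'⟩

theorem IsFrame.stepStar_of_approx {K : TmAt 0 U → TmAt 0 U} (hK : IsFrame K)
    {M M' v : TmAt 0 U} (h : M.Approx M') (hv : v.Val) (hM : StepStar (K M) v) :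
    StepStar (K M') v := by
  obtain ⟨w, hw, h'⟩ := hK.evals_arg ⟨hM, hv⟩
  exact (hK.stepStar (h.evals hw).1).trans h'

theorem isFrame_app (N : TmAt 0 U) : IsFrame fun M => M.app N where
  step := PreTm.Step.app
  not_val _ h := nomatch h
  step_inv {M P} h := by
    obtain ⟨M, hM⟩ := M
    obtain ⟨P, hP⟩ := P
    cases h with
    | @app _ M' _ hs => exact .inr ⟨⟨M', hP.1⟩, hs, rfl⟩
    | app_lam => exact .inl (.lam _)

theorem isFrame_kapp (κ : Fin U.card) : IsFrame fun M => M.kapp κ where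
  step := PreTm.Step.kapp
  not_val _ h := nomatch h
  step_inv {M P} h := by
    obtain ⟨M, hM⟩ := M
    obtain ⟨P, hP⟩ := P
    cases h with
    | @kapp _ M' _ hs => exact .inr ⟨⟨M', hP⟩, hs, rfl⟩
    | kapp_klam => exact .inl (.klam _)

theorem isFrame_fst : IsFrame (U := U) fst where
  step := PreTm.Step.fst
  not_val _ h := nomatch h
  step_inv {M P} h := by
    obtain ⟨M, hM⟩ := M
    obtain ⟨P, hP⟩ := P
    cases h with
    | @fst _ M' hs => exact .inr ⟨⟨M', hP⟩, hs, rfl⟩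
    | fst_pair => exact .inl (.pair _ _)

theorem isFrame_snd : IsFrame (U := U) snd where
  step := PreTm.Step.snd
  not_val _ h := nomatch h
  step_inv {M P} h := by
    obtain ⟨M, hM⟩ := M
    obtain ⟨P, hP⟩ := P
    cases h with
    | @snd _ M' hs => exact .inr ⟨⟨M', hP⟩, hs, rfl⟩
    | snd_pair => exact .inl (.pair _ _)

theorem Approx.app {M M' : TmAt 0 U} (h : M.Approx M') (N : TmAt 0 U) :
    (M.app N).Approx (M'.app N) :=
  fun _ f _ hv => (isFrame_app (N.restrict f)).stepStar_of_approx (h.restrict f) hv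

theorem Approx.kapp {M M' : TmAt 0 U} (h : M.Approx M') (κ : Fin U.card) :
    (M.kapp κ).Approx (M'.kapp κ) :=
  fun _ f _ hv => (isFrame_kapp (f.toFun κ)).stepStar_of_approx (h.restrict f) hv

theorem Approx.fst {M M' : TmAt 0 U} (h : M.Approx M') : M.fst.Approx M'.fst :=
  fun _ f _ hv => isFrame_fst.stepStar_of_approx (h.restrict f) hv

theorem Approx.snd {M M' : TmAt 0 U} (h : M.Approx M') : M.snd.Approx M'.snd :=
  fun _ f _ hv => isFrame_snd.stepStar_of_approx (h.restrict f) hv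

end TmAt

/-! ### Computational partial equivalence relations -/

section CPER

variable {U V : World}

theorem RelAt.mem_iff_rel_restrict {R : RelAt U} {f : V ⟶ U} {M N : TmAt 0 V} :
    RelAt.Mem R f M N ↔ RelAt.Rel (R.restrict f) M N := by
  change R.mem f _ ↔ R.mem (𝟙 V ≫ f) _
  rw [Category.id_comp]

theorem ExpAt.app_restrict {X : ClkTopos} (ℬ : ExpAt X Rel U) {V W : World} (f : V ⟶ U)
    (g : W ⟶ V) (x : El X V) : (ℬ.app f x).restrict g = ℬ.app (g ≫ f) (res x g) :=
  ℬ.natural f g x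

theorem IsCPER.restrict {R : RelAt U} (h : IsCPER R) (f : V ⟶ U) : IsCPER (R.restrict f) where
  symm _ g := h.symm (g ≫ f)
  trans _ g := h.trans (g ≫ f)
  computational _ g := h.computational (g ≫ f)

theorem IsCPER.mem_left {R : RelAt U} (h : IsCPER R) {f : V ⟶ U} {M N : TmAt 0 V}
    (hM : RelAt.Mem R f M N) : RelAt.Mem R f M M :=
  h.trans f _ _ _ hM (h.symm f _ _ hM)

theorem IsCPER.mem_right {R : RelAt U} (h : IsCPER R) {f : V ⟶ U} {M N : TmAt 0 V}
    (hM : RelAt.Mem R f M N) : RelAt.Mem R f N N :=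
  h.mem_left (h.symm f _ _ hM)

theorem RelAt.valClo_mem_trans {R S T : RelAt U} {f : V ⟶ U} {M N P : TmAt 0 V}
    (H : ∀ u v w : TmAt 0 V, RelAt.Mem R f u v → RelAt.Mem S f v w → RelAt.Mem T f u w)
    (h : RelAt.Mem (RelAt.valClo R) f M N) (h' : RelAt.Mem (RelAt.valClo S) f N P) :
    RelAt.Mem (RelAt.valClo T) f M P := by
  obtain ⟨u, v, hu, hv, huv⟩ := h
  obtain ⟨v', w, hv', hw, hvw⟩ := h'
  obtain rfl := hv.unique hv'
  exact ⟨u, w, hu, hw, H u v w huv hvw⟩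

theorem RelAt.valClo_mem_symm {R S : RelAt U} {f : V ⟶ U} {M N : TmAt 0 V}
    (H : ∀ u v : TmAt 0 V, RelAt.Mem R f u v → RelAt.Mem S f v u)
    (h : RelAt.Mem (RelAt.valClo R) f M N) : RelAt.Mem (RelAt.valClo S) f N M := by
  obtain ⟨u, v, hu, hv, huv⟩ := h
  exact ⟨v, u, hv, hu, H u v huv⟩

/-- The relation on values need not be closed under approximation for its closure under evaluation
to be a computational partial equivalence relation. -/
theorem isCPER_valClo {R : RelAt U}
    (hs : ∀ ⦃V : World⦄ (f : V ⟶ U) (M N : TmAt 0 V), RelAt.Mem R f M N → RelAt.Mem R f N M)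
    (ht : ∀ ⦃V : World⦄ (f : V ⟶ U) (M N P : TmAt 0 V),
      RelAt.Mem R f M N → RelAt.Mem R f N P → RelAt.Mem R f M P) :
    IsCPER (RelAt.valClo R) where
  symm _ f _ _ := RelAt.valClo_mem_symm (hs f)
  trans _ f _ _ _ := RelAt.valClo_mem_trans (ht f)
  computational _ _ _ _ _ := fun ⟨v, w, hv, hw, h⟩ hM => ⟨v, w, hM.evals hv, hw, h⟩

theorem TmAt.su_inj {M N : TmAt 0 U} (h : M.su = N.su) : M = N :=
  TmAt.ext (PreTm.su.inj (congrArg Subtype.val h))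

theorem TmAt.sup_inj {M M' : TmAt 0 U} {N N' : TmAt 1 U} (h : M.sup N = M'.sup N') :
    M = M' ∧ N = N' :=
  have h' := PreTm.sup.inj (congrArg Subtype.val h)
  ⟨TmAt.ext h'.1, TmAt.ext h'.2⟩

theorem TmAt.ze_ne_su {M : TmAt 0 U} : (TmAt.ze : TmAt 0 U) ≠ M.su :=
  fun h => nomatch congrArg Subtype.val h

theorem isCPER_bot : IsCPER (⊥ : RelAt U) :=
  ⟨fun _ _ _ _ h => h.elim, fun _ _ _ _ _ h => h.elim, fun _ _ _ _ _ h => h.elim⟩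

theorem isCPER_unit : IsCPER (RelAt.valClo (unitRel U)) :=
  isCPER_valClo (fun _ _ _ _ h => ⟨h.2, h.1⟩) fun _ _ _ _ _ h h' => ⟨h.1, h'.2⟩

theorem isCPER_bool : IsCPER (RelAt.valClo (boolRel U)) := by
  refine isCPER_valClo (fun _ _ _ _ h => h.imp And.symm And.symm) ?_
  rintro V f M N P (⟨rfl, rfl⟩ | ⟨rfl, rfl⟩) (⟨h, rfl⟩ | ⟨h, rfl⟩)
  · exact .inl ⟨rfl, rfl⟩
  · exact nomatch congrArg Subtype.val h
  · exact nomatch congrArg Subtype.val h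
  · exact .inr ⟨rfl, rfl⟩

/-- The converse of a relation. -/
def RelAt.swap (R : RelAt U) : RelAt U :=
  RelAt.mk (fun _ f M N => RelAt.Mem R f N M) fun _ _ _ g _ _ h => h.res g

/-- The largest relation whose composite with `R` is contained in `R`. -/
def RelAt.residual (R : RelAt U) : RelAt U :=
  RelAt.mk (fun V f M N => ∀ ⦃W : World⦄ (g : W ⟶ V) (P : TmAt 0 W),
      RelAt.Mem R (g ≫ f) (N.restrict g) P → RelAt.Mem R (g ≫ f) (M.restrict g) P)
    fun V W f g M N h W' k P hP => by
      have := h (k ≫ g) P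
      simp only [Category.assoc, TmAt.restrict_restrict] at this hP ⊢
      exact this hP

theorem RelAt.residual_mem {R : RelAt U} {f : V ⟶ U} {M N P : TmAt 0 V}
    (h : RelAt.Mem R.residual f M N) (h' : RelAt.Mem R f N P) : RelAt.Mem R f M P := by
  have := h (𝟙 V) P
  simp only [Category.id_comp, TmAt.restrict_id] at this
  exact this h'

/-- For a least fixed point on relations, symmetry and transitivity are instances of induction,
applied to the converse and to the residual of the fixed point. -/
theorem isCPER_valClo_lfp {Φ : RelAt U →o RelAt U}
    (hs : Φ (Φ.lfp).swap ≤ (Φ.lfp).swap) (ht : Φ (Φ.lfp).residual ≤ (Φ.lfp).residual) :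
    IsCPER (RelAt.valClo Φ.lfp) :=
  isCPER_valClo (fun _ f M N h => Φ.lfp_le hs f (M, N) h)
    fun _ f M N _ h h' => RelAt.residual_mem (Φ.lfp_le ht f (M, N) h) h'

theorem natRel_mem {f : V ⟶ U} {M N : TmAt 0 V} :
    RelAt.Mem (natRel U) f M N ↔ RelAt.Mem (natOp U (natRel U)) f M N := by
  rw [natRel, OrderHom.map_lfp]

theorem isCPER_nat : IsCPER (RelAt.valClo (natRel U)) := by
  refine isCPER_valClo_lfp ?_ ?_
  · rintro V f ⟨M, N⟩ h
    refine natRel_mem.2 ?_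
    rcases h with ⟨h, h'⟩ | ⟨M₀, M₁, h, h', hY⟩
    · exact .inl ⟨h', h⟩
    · exact .inr ⟨M₁, M₀, h', h, RelAt.valClo_mem_symm (fun _ _ h => h) hY⟩
  · rintro V f ⟨M, N⟩ h W g P hNP
    refine natRel_mem.2 ?_
    have hP := natRel_mem.1 hNP
    clear hNP
    rcases h with ⟨h, h'⟩ | ⟨M₀, M₁, h, h', hY⟩ <;> dsimp only at h h' hP ⊢ <;> subst h h'
    · rcases hP with ⟨-, rfl⟩ | ⟨_, _, h, -, -⟩
      · exact .inl ⟨rfl, rfl⟩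
      · exact absurd h TmAt.ze_ne_su
    · rcases hP with ⟨h, -⟩ | ⟨N₀, N₁, h, rfl, hN⟩
      · exact absurd h.symm (TmAt.ze_ne_su (M := M₁.restrict g))
      · obtain rfl := TmAt.su_inj (M := M₁.restrict g) h
        exact .inr ⟨M₀.restrict g, N₁, rfl, rfl,
          RelAt.valClo_mem_trans (fun _ _ _ h => RelAt.residual_mem h) (hY.res g) hN⟩

end CPER

/-! ### The connectives preserve computational partial equivalence relations -/

section Families

variable {U V : World}

/-- `𝒜` is a computational partial equivalence relation, and `ℬ` is a family of such relations
that respects `𝒜`. -/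
structure IsCPERFam (𝒜 : RelAt U) (ℬ : TmRelFam U) : Prop where
  base : IsCPER 𝒜
  fam : ∀ ⦃V : World⦄ (f : V ⟶ U) (M : TmAt 0 V), RelAt.Mem 𝒜 f M M → IsCPER (ℬ.app f M)
  respects : ∀ ⦃V : World⦄ (f : V ⟶ U) (M N : TmAt 0 V), RelAt.Mem 𝒜 f M N →
    ℬ.app f M = ℬ.app f N

theorem TmRelFam.mem_res_iff {ℬ : TmRelFam U} {W : World} {f : V ⟶ U} {g : W ⟶ V}
    {M : TmAt 0 V} {O P : TmAt 0 W} :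
    RelAt.Mem (ℬ.app f M) g O P ↔ RelAt.Rel (ℬ.app (g ≫ f) (M.restrict g)) O P := by
  rw [RelAt.mem_iff_rel_restrict, ExpAt.app_restrict]
  rfl

theorem isCPER_sg {𝒜 : RelAt U} {ℬ : TmRelFam U} (h : IsCPERFam 𝒜 ℬ) : IsCPER (sgRel 𝒜 ℬ) where
  symm V f M N := fun ⟨h₁, h₂⟩ => by
    refine ⟨h.base.symm f _ _ h₁, ?_⟩
    rw [← h.respects f _ _ h₁]
    exact (h.fam f _ (h.base.mem_left h₁)).symm _ _ _ h₂
  trans V f M N P := fun ⟨h₁, h₂⟩ ⟨h₁', h₂'⟩ => by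
    refine ⟨h.base.trans f _ _ _ h₁ h₁', ?_⟩
    rw [← h.respects f _ _ h₁] at h₂'
    exact (h.fam f _ (h.base.mem_left h₁)).trans _ _ _ _ h₂ h₂'
  computational V f M M' N := fun ⟨h₁, h₂⟩ hM => by
    have h₁' := h.base.computational f _ _ _ h₁ hM.fst
    refine ⟨h₁', ?_⟩
    rw [h.respects f _ _ h₁', ← h.respects f _ _ h₁]
    exact (h.fam f _ (h.base.mem_left h₁)).computational _ _ _ _ h₂ hM.snd

theorem isCPER_pi {𝒜 : RelAt U} {ℬ : TmRelFam U} (h : IsCPERFam 𝒜 ℬ) : IsCPER (piRel 𝒜 ℬ) where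
  symm V f M N H W g O₀ O₁ hO := by
    have := H g O₁ O₀ (h.base.symm _ _ _ hO)
    rw [h.respects _ _ _ hO]
    exact (h.fam _ _ (h.base.mem_right hO)).symm _ _ _ this
  trans V f M N P H H' W g O₀ O₁ hO :=
    (h.fam _ _ (h.base.mem_left hO)).trans _ _ _ _ (H g O₀ O₀ (h.base.mem_left hO)) (H' g O₀ O₁ hO)
  computational V f M M' N H hM W g O₀ O₁ hO :=
    (h.fam _ _ (h.base.mem_left hO)).computational _ _ _ _ (H g O₀ O₁ hO) ((hM.restrict g).app O₀)

theorem wRel_mem {𝒜 : RelAt U} {ℬ : TmRelFam U} {f : V ⟶ U} {M N : TmAt 0 V} :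
    RelAt.Mem (wRel 𝒜 ℬ) f M N ↔ RelAt.Mem (wOp 𝒜 ℬ (wRel 𝒜 ℬ)) f M N := by
  rw [wRel, OrderHom.map_lfp]

theorem isCPER_w {𝒜 : RelAt U} {ℬ : TmRelFam U} (h : IsCPERFam 𝒜 ℬ) :
    IsCPER (RelAt.valClo (wRel 𝒜 ℬ)) := by
  refine isCPER_valClo_lfp ?_ ?_
  · rintro V f ⟨M, N⟩ ⟨M₀, M₁, N₀, N₁, hM, hN, h𝒜, hY⟩
    refine wRel_mem.2 ⟨M₁, M₀, N₁, N₀, hN, hM, h.base.symm f _ _ h𝒜, fun W g O₀ O₁ hO => ?_⟩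
    rw [← h.respects f _ _ h𝒜] at hO
    exact RelAt.valClo_mem_symm (fun _ _ h => h)
      (hY g O₁ O₀ ((h.fam f _ (h.base.mem_left h𝒜)).symm _ _ _ hO))
  · rintro V f ⟨M, N⟩ ⟨M₀, M₁, N₀, N₁, hM, hN, h𝒜, hY⟩ W g P hNP
    dsimp only at hM hN
    subst hM hN
    obtain ⟨M₁', M₂, N₁', N₂, hN, rfl, h𝒜', hY'⟩ := wRel_mem.1 hNP
    obtain ⟨rfl, rfl⟩ := TmAt.sup_inj (M := M₁.restrict g) (N := N₁.restrict g) hN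
    refine wRel_mem.2 ⟨M₀.restrict g, M₂, N₀.restrict g, N₂, rfl, rfl,
      h.base.trans _ _ _ _ (h𝒜.res g) h𝒜', fun W' k O₀ O₁ hO => ?_⟩
    -- Go from `N₀[O₀]` to `N₁[O₀]` by induction, which needs `O₀` to be related to itself, and
    -- from there to `N₂[O₁]` by the assumption on the second pair.
    have hO' := (h.fam _ _ (h.base.mem_left (h𝒜.res g))).mem_left hO
    rw [TmRelFam.mem_res_iff, TmAt.restrict_restrict, ← Category.assoc,
      ← TmRelFam.mem_res_iff] at hO'
    have h₁ := hY (k ≫ g) O₀ O₀ hO'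
    rw [h.respects _ _ _ (h𝒜.res g)] at hO
    have h₂ := hY' k O₀ O₁ hO
    simp only [TmAt.restrict_restrict, Category.assoc] at h₁ h₂ ⊢
    exact RelAt.valClo_mem_trans (fun _ _ _ h => RelAt.residual_mem h) h₁ h₂

theorem isCPER_eq (𝒜 : RelAt U) (M₀ M₁ : TmAt 0 U) : IsCPER (RelAt.valClo (eqRel 𝒜 M₀ M₁)) :=
  isCPER_valClo (fun _ _ _ _ h => ⟨h.2.1, h.1, h.2.2⟩) fun _ _ _ _ _ h h' => ⟨h.1, h'.2⟩

/-- Only the restriction of `𝒜` to the world at which the clock has ticked matters. -/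
theorem ltrRel_mem_iff {κ : Fin U.card} {𝒜 : RelAt U} {f : V ⟶ U} {M N : TmAt 0 V} :
    RelAt.Mem (ltrRel κ 𝒜) f M N ↔
      ∀ (m n : ℕ) (hU : U.time κ = m + 1) (hV : V.time (f.toFun κ) = n + 1),
        RelAt.Mem (𝒜.restrict (U.tick κ m hU)) (World.setMap f κ m n hU hV)
          (M.restrict (V.tick (f.toFun κ) n hV)) (N.restrict (V.tick (f.toFun κ) n hV)) := by
  constructor
  · intro H m n hU hV
    exact H n hV
  · intro H n hV
    obtain ⟨m, hU⟩ : ∃ m, U.time κ = m + 1 :=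
      ⟨U.time κ - 1, by have := f.time_le κ; omega⟩
    exact H m n hU hV

theorem isCPER_ltr {κ : Fin U.card} {𝒜 : RelAt U} (h : Later κ fun _ f => IsCPER (𝒜.restrict f)) :
    IsCPER (ltrRel κ 𝒜) where
  symm V f M N H := by
    rw [ltrRel_mem_iff] at H ⊢
    exact fun m n hU hV => (h m hU).symm _ _ _ (H m n hU hV)
  trans V f M N P H H' := by
    rw [ltrRel_mem_iff] at H H' ⊢
    exact fun m n hU hV => (h m hU).trans _ _ _ _ (H m n hU hV) (H' m n hU hV)
  computational V f M M' N H hM := by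
    rw [ltrRel_mem_iff] at H ⊢
    exact fun m n hU hV => (h m hU).computational _ _ _ _ (H m n hU hV) (hM.restrict _)

theorem isCPER_isect {𝒜 : ClkRelFam U}
    (h : ∀ ⦃V : World⦄ (f : V ⟶ U) (κ : Fin V.card), IsCPER (𝒜.app f κ)) :
    IsCPER (isectRel 𝒜) where
  symm _ _ _ _ H _ g κ := (h _ κ).symm _ _ _ (H g κ)
  trans _ _ _ _ _ H H' _ g κ := (h _ κ).trans _ _ _ _ (H g κ) (H' g κ)
  computational _ _ _ _ _ H hM _ g κ := (h _ κ).computational _ _ _ _ (H g κ) (hM.restrict g)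

theorem isCPER_kprod {𝒜 : ClkRelFam U}
    (h : ∀ ⦃V : World⦄ (f : V ⟶ U) (κ : Fin V.card), IsCPER (𝒜.app f κ)) :
    IsCPER (kprodRel 𝒜) where
  symm _ _ _ _ H _ g κ := (h _ κ).symm _ _ _ (H g κ)
  trans _ _ _ _ _ H H' _ g κ := (h _ κ).trans _ _ _ _ (H g κ) (H' g κ)
  computational _ _ _ _ _ H hM _ g κ :=
    (h _ κ).computational _ _ _ _ (H g κ) ((hM.restrict g).kapp κ)

/-! ### Dependence of the connectives on their parameters -/

theorem RelAt.ext {R S : RelAt U}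
    (h : ∀ ⦃V : World⦄ (f : V ⟶ U) (M N : TmAt 0 V), RelAt.Mem R f M N ↔ RelAt.Mem S f M N) :
    R = S :=
  PowAt.ext (funext fun _ => funext fun f => funext fun p => propext (h f p.1 p.2))

variable {𝒜 : RelAt U} {ℬ ℬ' : TmRelFam U}

theorem sgRel_congr (h : ∀ ⦃V : World⦄ (f : V ⟶ U) (M N : TmAt 0 V),
      RelAt.Mem 𝒜 f M N → ℬ.app f M = ℬ'.app f M) : sgRel 𝒜 ℬ = sgRel 𝒜 ℬ' :=
  RelAt.ext fun V f M N => and_congr_right fun hM => by rw [h f _ _ hM]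

theorem piRel_congr (h : ∀ ⦃V : World⦄ (f : V ⟶ U) (M N : TmAt 0 V),
      RelAt.Mem 𝒜 f M N → ℬ.app f M = ℬ'.app f M) : piRel 𝒜 ℬ = piRel 𝒜 ℬ' :=
  RelAt.ext fun V f M N => forall_congr' fun W => forall_congr' fun g => forall₂_congr fun O₀ O₁ =>
    forall_congr' fun hO => by rw [h _ _ _ hO]

theorem wRel_congr (h : ∀ ⦃V : World⦄ (f : V ⟶ U) (M N : TmAt 0 V),
      RelAt.Mem 𝒜 f M N → ℬ.app f M = ℬ'.app f M) : wRel 𝒜 ℬ = wRel 𝒜 ℬ' := by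
  suffices e : wOp 𝒜 ℬ = wOp 𝒜 ℬ' by rw [wRel, e, wRel]
  refine OrderHom.ext _ _ (funext fun Y => RelAt.ext fun V f M N => ?_)
  refine exists₄_congr fun M₀ M₁ N₀ N₁ => and_congr_right fun _ => and_congr_right fun _ =>
    and_congr_right fun hM => ?_
  rw [h _ _ _ hM]

theorem ltrRel_congr {κ : Fin U.card} {𝒜 𝒜' : RelAt U}
    (h : Later κ fun _ f => 𝒜.restrict f = 𝒜'.restrict f) : ltrRel κ 𝒜 = ltrRel κ 𝒜' := by
  refine RelAt.ext fun V f M N => ?_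
  rw [ltrRel_mem_iff, ltrRel_mem_iff]
  exact forall₄_congr fun m n hU hV => by rw [h m hU]

theorem ClkRelFam.ext {𝒜 𝒜' : ClkRelFam U}
    (h : ∀ ⦃V : World⦄ (f : V ⟶ U) (κ : Fin V.card), 𝒜.app f κ = 𝒜'.app f κ) : 𝒜 = 𝒜' :=
  ExpAt.ext (funext fun _ => funext fun f => funext fun κ => h f κ)

end Families

/-! ### The clauses determine a unique computational partial equivalence relation -/

section Clauses

variable {U : World}

/-- `Z` is a part of `τ` consisting of computational partial equivalence relations, each of which
is the only value that `τ` assigns to its type. This is the induction hypothesis in the proof that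
the closure of a type system is a type system: `τ` is the closure, and `Z` the pairs that are
already known to be well-behaved. -/
structure IsDetermined (τ Z : PTSAt U) : Prop where
  le : Z ≤ τ
  cper : ∀ ⦃V : World⦄ (f : V ⟶ U) (A : TmAt 0 V) (R : RelAt V), PTSAt.Mem Z f A R → IsCPER R
  unique : ∀ ⦃V : World⦄ (f : V ⟶ U) (A : TmAt 0 V) (R S : RelAt V),
    PTSAt.Mem Z f A R → PTSAt.Mem τ f A S → R = S

theorem IsDetermined.restrict {V : World} {τ Z : PTSAt U} (h : IsDetermined τ Z) (f : V ⟶ U) :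
    IsDetermined (τ.restrict f) (Z.restrict f) where
  le := PowAt.restrict_mono h.le f
  cper _ g := h.cper (g ≫ f)
  unique _ g := h.unique (g ≫ f)

theorem IsDetermined.isCPERFam {τ Z : PTSAt U} (hZ : IsDetermined τ Z) {A : TmAt 0 U}
    {B : TmAt 1 U} {𝒜 : RelAt U} {ℬ : TmRelFam U} (h : IsFam Z A B 𝒜 ℬ) : IsCPERFam 𝒜 ℬ where
  base := hZ.cper _ _ _ h.base
  fam _ f M hM := hZ.cper _ _ _ (h.fam f M M hM).1
  respects _ f M N hM := by
    obtain ⟨h₁, -, -, h₂⟩ := h.fam f M N hM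
    exact hZ.unique f _ _ _ h₁ (hZ.le _ _ h₂)

theorem IsDetermined.fam_unique {τ Z : PTSAt U} (hZ : IsDetermined τ Z) {A : TmAt 0 U}
    {B : TmAt 1 U} {𝒜 𝒜' : RelAt U} {ℬ ℬ' : TmRelFam U} (h : IsFam Z A B 𝒜 ℬ)
    (h' : IsFam τ A B 𝒜' ℬ') : 𝒜 = 𝒜' ∧ ∀ ⦃V : World⦄ (f : V ⟶ U) (M N : TmAt 0 V),
      RelAt.Mem 𝒜 f M N → ℬ.app f M = ℬ'.app f M := by
  obtain rfl := hZ.unique _ _ _ _ h.base h'.base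
  exact ⟨rfl, fun V f M N hM => hZ.unique f _ _ _ (h.fam f M N hM).1 (h'.fam f M N hM).1⟩

/-- A clause is determinate if it preserves the property of being determined. -/
structure Clause.IsDeterminate (c : Clause) : Prop where
  cper : ∀ {U : World} {τ Z : PTSAt U} {A : TmAt 0 U} {R : RelAt U}, IsDetermined τ Z →
    c.holds Z A R → IsCPER R
  unique : ∀ {U : World} {τ Z : PTSAt U} {A : TmAt 0 U} {R S : RelAt U}, IsDetermined τ Z →
    c.holds Z A R → c.holds τ A S → R = S

theorem isDeterminate_clVoid : clVoid.IsDeterminate where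
  cper := fun _ ⟨_, h⟩ => h ▸ isCPER_bot
  unique := fun _ ⟨_, h⟩ ⟨_, h'⟩ => h.trans h'.symm

theorem isDeterminate_clUnit : clUnit.IsDeterminate where
  cper := fun _ ⟨_, h⟩ => h ▸ isCPER_unit
  unique := fun _ ⟨_, h⟩ ⟨_, h'⟩ => h.trans h'.symm

theorem isDeterminate_clBool : clBool.IsDeterminate where
  cper := fun _ ⟨_, h⟩ => h ▸ isCPER_bool
  unique := fun _ ⟨_, h⟩ ⟨_, h'⟩ => h.trans h'.symm

theorem isDeterminate_clNat : clNat.IsDeterminate where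
  cper := fun _ ⟨_, h⟩ => h ▸ isCPER_nat
  unique := fun _ ⟨_, h⟩ ⟨_, h'⟩ => h.trans h'.symm

theorem isDeterminate_clSg : clSg.IsDeterminate where
  cper := by
    rintro U τ Z C R hZ ⟨A, B, rfl, 𝒜, ℬ, hF, rfl⟩
    exact isCPER_sg (hZ.isCPERFam hF)
  unique := by
    rintro U τ Z C R S hZ ⟨A, B, rfl, 𝒜, ℬ, hF, rfl⟩ ⟨A', B', h, 𝒜', ℬ', hF', rfl⟩
    obtain ⟨hA, hB⟩ := PreTm.sg.inj (congrArg Subtype.val h)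
    obtain rfl := TmAt.ext hA
    obtain rfl := TmAt.ext hB
    obtain ⟨rfl, hℬ⟩ := hZ.fam_unique hF hF'
    exact sgRel_congr hℬ

theorem isDeterminate_clPi : clPi.IsDeterminate where
  cper := by
    rintro U τ Z C R hZ ⟨A, B, rfl, 𝒜, ℬ, hF, rfl⟩
    exact isCPER_pi (hZ.isCPERFam hF)
  unique := by
    rintro U τ Z C R S hZ ⟨A, B, rfl, 𝒜, ℬ, hF, rfl⟩ ⟨A', B', h, 𝒜', ℬ', hF', rfl⟩
    obtain ⟨hA, hB⟩ := PreTm.pi.inj (congrArg Subtype.val h)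
    obtain rfl := TmAt.ext hA
    obtain rfl := TmAt.ext hB
    obtain ⟨rfl, hℬ⟩ := hZ.fam_unique hF hF'
    exact piRel_congr hℬ

theorem isDeterminate_clW : clW.IsDeterminate where
  cper := by
    rintro U τ Z C R hZ ⟨A, B, rfl, 𝒜, ℬ, hF, rfl⟩
    exact isCPER_w (hZ.isCPERFam hF)
  unique := by
    rintro U τ Z C R S hZ ⟨A, B, rfl, 𝒜, ℬ, hF, rfl⟩ ⟨A', B', h, 𝒜', ℬ', hF', rfl⟩
    obtain ⟨hA, hB⟩ := PreTm.wty.inj (congrArg Subtype.val h)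
    obtain rfl := TmAt.ext hA
    obtain rfl := TmAt.ext hB
    obtain ⟨rfl, hℬ⟩ := hZ.fam_unique hF hF'
    rw [wRel_congr hℬ]

theorem isDeterminate_clEq : clEq.IsDeterminate where
  cper := by
    rintro U τ Z C R hZ ⟨A, M₀, M₁, rfl, 𝒜, hA, -, -, rfl⟩
    exact isCPER_eq _ _ _
  unique := by
    rintro U τ Z C R S hZ ⟨A, M₀, M₁, rfl, 𝒜, hA, -, -, rfl⟩
      ⟨A', M₀', M₁', h, 𝒜', hA', -, -, rfl⟩
    obtain ⟨h, h₀, h₁⟩ := PreTm.eq.inj (congrArg Subtype.val h)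
    obtain rfl := TmAt.ext h
    obtain rfl := TmAt.ext h₀
    obtain rfl := TmAt.ext h₁
    rw [hZ.unique _ _ _ _ hA hA']

theorem isDeterminate_clLtr : clLtr.IsDeterminate where
  cper := by
    rintro U τ Z C R hZ ⟨κ, A, rfl, 𝒜, hA, rfl⟩
    exact isCPER_ltr fun m h => hZ.cper _ _ _ (hA m h)
  unique := by
    rintro U τ Z C R S hZ ⟨κ, A, rfl, 𝒜, hτ, rfl⟩ ⟨κ', A', h, 𝒜', hτ', rfl⟩
    obtain ⟨rfl, hA⟩ := PreTm.ltr.inj (congrArg Subtype.val h)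
    obtain rfl := TmAt.ext hA
    exact ltrRel_congr fun m h => hZ.unique _ _ _ _ (hτ m h) (hτ' m h)

theorem TmAt.isect_inj {F G : ClkFam 0 U} (h : TmAt.isect F = TmAt.isect G) : F = G := by
  have h := PreTm.isect.inj (congrArg Subtype.val h)
  exact ExpAt.ext (funext fun V => funext fun f => funext fun κ =>
    TmAt.ext (congrFun (congrFun (congrFun h V) f) κ))

theorem TmAt.kprod_inj {F G : ClkFam 0 U} (h : TmAt.kprod F = TmAt.kprod G) : F = G := by
  have h := PreTm.kprod.inj (congrArg Subtype.val h)
  exact ExpAt.ext (funext fun V => funext fun f => funext fun κ =>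
    TmAt.ext (congrFun (congrFun (congrFun h V) f) κ))

theorem isDeterminate_clIsect : clIsect.IsDeterminate where
  cper := by
    rintro U τ Z C R hZ ⟨F, rfl, 𝒜, hF, rfl⟩
    exact isCPER_isect fun V f κ => hZ.cper _ _ _ (hF f κ)
  unique := by
    rintro U τ Z C R S hZ ⟨F, rfl, 𝒜, hF, rfl⟩ ⟨F', h, 𝒜', hF', rfl⟩
    obtain rfl := TmAt.isect_inj h
    rw [ClkRelFam.ext fun V f κ => hZ.unique _ _ _ _ (hF f κ) (hF' f κ)]

theorem isDeterminate_clKprod : clKprod.IsDeterminate where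
  cper := by
    rintro U τ Z C R hZ ⟨F, rfl, 𝒜, hF, rfl⟩
    exact isCPER_kprod fun V f κ => hZ.cper _ _ _ (hF f κ)
  unique := by
    rintro U τ Z C R S hZ ⟨F, rfl, 𝒜, hF, rfl⟩ ⟨F', h, 𝒜', hF', rfl⟩
    obtain rfl := TmAt.kprod_inj h
    rw [ClkRelFam.ext fun V f κ => hZ.unique _ _ _ _ (hF f κ) (hF' f κ)]

end Clauses

/-! ### The closure of a type system -/

/-- The clause of the type former at the head of a program: the clauses have disjoint domains. -/
def PreTm.clause {U : World} : PreTm U 0 → Option Clause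
  | .void => some clVoid
  | .unit => some clUnit
  | .bool => some clBool
  | .nat => some clNat
  | .sg _ _ => some clSg
  | .pi _ _ => some clPi
  | .wty _ _ => some clW
  | .eq _ _ _ => some clEq
  | .ltr _ _ => some clLtr
  | .isect _ => some clIsect
  | .kprod _ => some clKprod
  | _ => none

section Closure

variable {U V : World}

theorem exists_clause_of_mem_conns {τ : PTSAt U} {f : V ⟶ U} {A : TmAt 0 V} {R : RelAt V}
    (h : PTSAt.Mem (conns U τ) f A R) : ∃ c, A.1.clause = some c ∧ c.IsDeterminate ∧
      c.holds (τ.restrict f) A R := by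
  rcases h with ((((((((((h | h) | h) | h) | h) | h) | h) | h) | h) | h) | h)
  · exact ⟨clVoid, by obtain ⟨rfl, -⟩ := h; rfl, isDeterminate_clVoid, h⟩
  · exact ⟨clUnit, by obtain ⟨rfl, -⟩ := h; rfl, isDeterminate_clUnit, h⟩
  · exact ⟨clBool, by obtain ⟨rfl, -⟩ := h; rfl, isDeterminate_clBool, h⟩
  · exact ⟨clNat, by obtain ⟨rfl, -⟩ := h; rfl, isDeterminate_clNat, h⟩
  · exact ⟨clSg, by obtain ⟨_, _, rfl, -⟩ := h; rfl, isDeterminate_clSg, h⟩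
  · exact ⟨clPi, by obtain ⟨_, _, rfl, -⟩ := h; rfl, isDeterminate_clPi, h⟩
  · exact ⟨clKprod, by obtain ⟨_, rfl, -⟩ := h; rfl, isDeterminate_clKprod, h⟩
  · exact ⟨clEq, by obtain ⟨_, _, _, rfl, -⟩ := h; rfl, isDeterminate_clEq, h⟩
  · exact ⟨clLtr, by obtain ⟨_, _, rfl, -⟩ := h; rfl, isDeterminate_clLtr, h⟩
  · exact ⟨clIsect, by obtain ⟨_, rfl, -⟩ := h; rfl, isDeterminate_clIsect, h⟩
  · exact ⟨clW, by obtain ⟨_, _, rfl, -⟩ := h; rfl, isDeterminate_clW, h⟩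

theorem not_mem_conns_univ {τ : PTSAt U} {f : V ⟶ U} {i : ℕ} {R : RelAt V} :
    ¬ PTSAt.Mem (conns U τ) f (.univ i) R := fun h => by
  obtain ⟨c, hc, -⟩ := exists_clause_of_mem_conns h
  exact nomatch hc

theorem IsDetermined.conns_cper {τ Z : PTSAt U} (hZ : IsDetermined τ Z) {f : V ⟶ U} {A : TmAt 0 V}
    {R : RelAt V} (h : PTSAt.Mem (conns U Z) f A R) : IsCPER R := by
  obtain ⟨c, -, hc, h⟩ := exists_clause_of_mem_conns h
  exact hc.cper (hZ.restrict f) h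

theorem IsDetermined.conns_unique {τ Z : PTSAt U} (hZ : IsDetermined τ Z) {f : V ⟶ U}
    {A : TmAt 0 V} {R S : RelAt V} (h : PTSAt.Mem (conns U Z) f A R)
    (h' : PTSAt.Mem (conns U τ) f A S) : R = S := by
  obtain ⟨c, hA, hc, h⟩ := exists_clause_of_mem_conns h
  obtain ⟨c', hA', -, h'⟩ := exists_clause_of_mem_conns h'
  obtain rfl : c = c' := Option.some.inj (hA.symm.trans hA')
  exact hc.unique (hZ.restrict f) h h'

/-- The largest part of `τ` that is determined in `τ`. -/
def determinedPart (τ : PTSAt U) : PTSAt U :=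
  PTSAt.mk (fun V f A R => PTSAt.Mem τ f A R ∧ IsCPER R ∧ ∀ ⦃W : World⦄ (g : W ⟶ V) (S : RelAt W),
      PTSAt.Mem τ (g ≫ f) (A.restrict g) S → R.restrict g = S)
    fun V W f g A R ⟨h, hR, H⟩ => ⟨h.res g, hR.restrict g, fun W' k S hS => by
      rw [TmAt.restrict_restrict, ← Category.assoc] at hS
      rw [← H (k ≫ g) S hS]
      exact res_res (X := Rel) R g k⟩

theorem PowAt.restrict_id {X : ClkTopos} (R : PowAt X U) : R.restrict (𝟙 U) = R :=
  res_id (X := Pow X) R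

theorem isDetermined_determinedPart (τ : PTSAt U) : IsDetermined τ (determinedPart τ) where
  le _ _ _ h := h.1
  cper _ _ _ _ h := h.2.1
  unique _ f A R S h hS := by
    have := h.2.2 (𝟙 _) S
    rw [Category.id_comp, TmAt.restrict_id, PowAt.restrict_id] at this
    exact this hS

theorem mem_tsClose_iff {σ : PTSAt U} {f : V ⟶ U} {A : TmAt 0 V} {R : RelAt V} :
    PTSAt.Mem (tsClose σ) f A R ↔ PTSAt.Mem σ f A R ∨
      ∃ v, A.Evals v ∧ PTSAt.Mem (conns U (tsClose σ)) f v R := by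
  change _ ↔ PTSAt.Mem (tsFun σ (tsClose σ)) f A R
  rw [tsClose, OrderHom.map_lfp]

theorem tsClose_mono {σ σ' : PTSAt U} (h : σ ≤ σ') : tsClose σ ≤ tsClose σ' :=
  OrderHom.lfp.monotone fun _ => sup_le_sup_right h _

/-- All types of `σ` evaluate to universes. -/
def IsUniversal (σ : PTSAt U) : Prop :=
  ∀ ⦃V : World⦄ (f : V ⟶ U) (A : TmAt 0 V) (R : RelAt V), PTSAt.Mem σ f A R →
    ∃ i, A.Evals (.univ i)

/-- Extensionality and the properties of the values are proved by a single induction: that the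
relation assigned to a type with a family of arguments is transitive rests on the uniqueness of the
relations assigned to the members of the family. -/
theorem tsClose_le_determinedPart {σ : PTSAt U} (hσ : IsTypeSystem σ) (hu : IsUniversal σ) :
    tsClose σ ≤ determinedPart (tsClose σ) := by
  have hZ := isDetermined_determinedPart (tsClose σ)
  have hle : tsFun σ (determinedPart (tsClose σ)) ≤ tsClose σ :=
    ((tsFun σ).mono hZ.le).trans (tsFun σ).map_lfp.le
  refine (tsFun σ).lfp_le fun V f ⟨A, R⟩ h => ⟨hle f _ h, ?_⟩
  rcases h with h | ⟨v, hv, h⟩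
  · refine ⟨hσ.cperValued f A R h, fun W g _ hS => ?_⟩
    have h := PTSAt.Mem.res h g
    rcases mem_tsClose_iff.1 hS with hS | ⟨w, hw, hS⟩
    · exact hσ.extensional _ _ _ _ h hS
    · obtain ⟨i, hi⟩ := hu _ _ _ h
      obtain rfl := hw.unique hi
      exact absurd hS not_mem_conns_univ
  · refine ⟨hZ.conns_cper h, fun W g _ hS => ?_⟩
    have h := PTSAt.Mem.res h g
    have hv := TmAt.Evals.restrict hv g
    rcases mem_tsClose_iff.1 hS with hS | ⟨w, hw, hS⟩
    · obtain ⟨i, hi⟩ := hu _ _ _ hS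
      rw [hv.unique hi] at h
      exact absurd h not_mem_conns_univ
    · obtain rfl := hv.unique hw
      exact hZ.conns_unique h hS

theorem IsTypeSystem.tsClose {σ : PTSAt U} (hσ : IsTypeSystem σ) (hu : IsUniversal σ) :
    IsTypeSystem (tsClose σ) where
  extensional _ f A R S hR hS :=
    (isDetermined_determinedPart _).unique f A R S (tsClose_le_determinedPart hσ hu f _ hR) hS
  cperValued _ f A R hR := (tsClose_le_determinedPart hσ hu f _ hR).2.1
  typeComputational _ f A A' R hR hA := by
    rw [mem_tsClose_iff] at hR ⊢
    rcases hR with hR | ⟨v, hv, hR⟩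
    · exact .inl (hσ.typeComputational f A A' R hR hA)
    · exact .inr ⟨v, hA.evals hv, hR⟩

end Closure

/-! ### The universe hierarchy -/

section Hierarchy

variable {U V : World}

theorem isCPER_univRel {τ : PTSAt U} (hτ : IsTypeSystem τ) : IsCPER (univRel τ) where
  symm _ _ _ _ := fun ⟨R, h₀, h₁⟩ => ⟨R, h₁, h₀⟩
  trans _ f _ _ _ := fun ⟨R, h₀, h₁⟩ ⟨_, h₁', h₂⟩ =>
    ⟨R, h₀, hτ.extensional f _ _ _ h₁ h₁' ▸ h₂⟩
  computational _ f _ _ _ := fun ⟨R, h₀, h₁⟩ hA =>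
    ⟨R, hτ.typeComputational f _ _ _ h₀ hA, h₁⟩

theorem not_mem_spine_zero {f : V ⟶ U} {A : TmAt 0 V} {R : RelAt V} :
    ¬ PTSAt.Mem (GlobalPTS.at (spine 0) U) f A R := by
  rw [spine]
  exact id

theorem mem_spine_succ {n : ℕ} {f : V ⟶ U} {A : TmAt 0 V} {R : RelAt V} :
    PTSAt.Mem (GlobalPTS.at (spine (n + 1)) U) f A R ↔
      ∃ i ≤ n, A.Evals (.univ i) ∧ R = univRel (GlobalPTS.at (tower i) V) := by
  rw [spine]
  constructor
  · rintro ⟨v, hv, i, hi, rfl, hR⟩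
    exact ⟨i, hi, hv, hR⟩
  · rintro ⟨i, hi, hv, hR⟩
    exact ⟨.univ i, hv, i, hi, rfl, hR⟩

theorem isUniversal_spine (n : ℕ) : IsUniversal (GlobalPTS.at (spine n) U) := by
  intro V f A R h
  cases n with
  | zero => exact absurd h not_mem_spine_zero
  | succ n =>
    obtain ⟨i, -, hA, -⟩ := mem_spine_succ.1 h
    exact ⟨i, hA⟩

theorem isTypeSystem_tower (n : ℕ) (U : World) : IsTypeSystem (GlobalPTS.at (tower n) U) := by
  induction n using Nat.strong_induction_on generalizing U with
  | _ n ih =>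
    refine IsTypeSystem.tsClose (σ := GlobalPTS.at (spine n) U) ?_ (isUniversal_spine n)
    cases n with
    | zero =>
      exact ⟨fun _ _ _ _ _ h => absurd h not_mem_spine_zero,
        fun _ _ _ _ h => absurd h not_mem_spine_zero,
        fun _ _ _ _ _ h => absurd h not_mem_spine_zero⟩
    | succ n =>
      refine ⟨fun V f A R S hR hS => ?_, fun V f A R hR => ?_, fun V f A A' R hR hA => ?_⟩
      · obtain ⟨i, -, hi, rfl⟩ := mem_spine_succ.1 hR
        obtain ⟨j, -, hj, rfl⟩ := mem_spine_succ.1 hS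
        obtain rfl : i = j := PreTm.univ.inj (congrArg Subtype.val (hi.unique hj))
        rfl
      · obtain ⟨i, hi, -, rfl⟩ := mem_spine_succ.1 hR
        exact isCPER_univRel (ih i (Nat.lt_succ_of_le hi) V)
      · obtain ⟨i, hi, hv, hS⟩ := mem_spine_succ.1 hR
        exact mem_spine_succ.2 ⟨i, hi, hA.evals hv, hS⟩

theorem tower_mono (U : World) : Monotone fun n => GlobalPTS.at (tower n) U := by
  intro n m hnm
  refine tsClose_mono (σ := GlobalPTS.at (spine n) U) (σ' := GlobalPTS.at (spine m) U)
    fun V f ⟨A, R⟩ h => ?_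
  cases n with
  | zero => exact absurd h not_mem_spine_zero
  | succ n =>
    obtain ⟨m, rfl⟩ : ∃ k, m = k + 1 := ⟨m - 1, by omega⟩
    obtain ⟨i, hi, hA⟩ := mem_spine_succ.1 h
    exact mem_spine_succ.2 ⟨i, by omega, hA⟩

theorem mem_tauOmega {f : V ⟶ U} {A : TmAt 0 V} {R : RelAt V} :
    PTSAt.Mem (GlobalPTS.at tauOmega U) f A R ↔
      ∃ n, PTSAt.Mem (GlobalPTS.at (tower n) U) f A R := by
  change (∃ R ∈ Set.range _, _) ↔ _
  rw [Set.exists_range_iff]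
  rfl

end Hierarchy

end GCTT

theorem mainTheorem3 :
    ∀ U : GCTT.World, GCTT.IsTypeSystem (GCTT.GlobalPTS.at GCTT.tauOmega U) := by
  intro U
  refine ⟨fun V f A R S hR hS => ?_, fun V f A R hR => ?_, fun V f A A' R hR hA => ?_⟩
  · obtain ⟨n, hn⟩ := GCTT.mem_tauOmega.1 hR
    obtain ⟨m, hm⟩ := GCTT.mem_tauOmega.1 hS
    exact (GCTT.isTypeSystem_tower (max n m) U).extensional f A R S
      (GCTT.tower_mono U (le_max_left n m) f _ hn) (GCTT.tower_mono U (le_max_right n m) f _ hm)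
  · obtain ⟨n, hn⟩ := GCTT.mem_tauOmega.1 hR
    exact (GCTT.isTypeSystem_tower n U).cperValued f A R hn
  · obtain ⟨n, hn⟩ := GCTT.mem_tauOmega.1 hR
    exact GCTT.mem_tauOmega.2 ⟨n, (GCTT.isTypeSystem_tower n U).typeComputational f A A' R hn hA⟩
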